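/- Let $A,B,C,D\in\mathbb C^{m\times n}$, and suppose that each of the matrix equations $AX=B$ and $CY=D$ has a Hermitian solution. Let $$\mathcal S=\{X\in\mathbb C^{n\times n} : X=X^*,\ AX=B\},\qquad \mathcal T=\{Y\in\mathbb C^{n\times n} : Y=Y^*,\ CY=D\},$$ $$M=\begin{bmatrix}AB^*&0&A\\0&-CD^*&C\\A^*&C^*&0\end{bmatrix},\qquad N=\begin{bmatrix}A&B\\C&D\end{bmatrix}.$$ Here $r(\cdot)$ denotes rank, $\mathscr R(\cdot)$ the column space, and $i_+(H)$, $i_-(H)$ the numbers of positive and of negative eigenvalues, counted with multiplicity, of a Hermitian matrix $H$ (the matrix $M$ is Hermitian under the above assumption). For Hermitian $X,Y$, $X\succ Y$ ($X\succcurlyeq Y$) means that $X-Y$ is positive definite (positive semidefinite), and $X\prec Y$ ($X\preccurlyeq Y$) means $Y\succ X$ ($Y\succcurlyeq X$). Then the following maxima and minima are attained and $$\max_{X\in\mathcal S,\,Y\in\mathcal T} r(X-Y)=n+r(N)-r(A)-r(C),$$ $$\min_{X\in\mathcal S,\,Y\in\mathcal T} r(X-Y)=2r(N)+r(AD^*-BC^*)-r\begin{bmatrix}A&BA^*\\C&DA^*\end{bmatrix}-r\begin{bmatrix}A&BC^*\\C&DC^*\end{bmatrix},$$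 $$\max_{X\in\mathcal S,\,Y\in\mathcal T} i_\pm(X-Y)=n+i_\pm(M)-r(A)-r(C),\qquad \min_{X\in\mathcal S,\,Y\in\mathcal T} i_\pm(X-Y)=r(N)-i_\mp(M).$$ In consequence, the following hold. (a) There exist $X\in\mathcal S$ and $Y\in\mathcal T$ such that $X-Y$ is nonsingular if and only if $r(N)=r(A)+r(C)$. (b) $X-Y$ is nonsingular for all $X\in\mathcal S$ and $Y\in\mathcal T$ if and only if $$2r(N)+r(AD^*-BC^*)=r\begin{bmatrix}A&BA^*\\C&DA^*\end{bmatrix}+r\begin{bmatrix}A&BC^*\\C&DC^*\end{bmatrix}+n.$$ (c) $\mathcal S\cap\mathcal T\neq\emptyset$ if and only if $$\mathscr R\begin{bmatrix}B\\D\end{bmatrix}\subseteq\mathscr R\begin{bmatrix}A\\C\end{bmatrix}\quad\text{and}\quad\begin{bmatrix}A\\C\end{bmatrix}[\,B^*,\ D^*\,]=\begin{bmatrix}B\\D\end{bmatrix}[\,A^*,\ C^*\,].$$ (d) There exist $X\in\mathcal S$ and $Y\in\mathcal T$ such that $X\succ Y$ (respectively $X\prec Y$) if and only if $i_+(M)=r(A)+r(C)$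 (respectively $i_-(M)=r(A)+r(C)$). (e) $X\succ Y$ (respectively $X\prec Y$) holds for all $X\in\mathcal S$ and $Y\in\mathcal T$ if and only if $i_-(M)=r(N)-n$ (respectively $i_+(M)=r(N)-n$). (f) There exist $X\in\mathcal S$ and $Y\in\mathcal T$ such that $X\succcurlyeq Y$ (respectively $X\preccurlyeq Y$) if and only if $i_+(M)=r(N)$ (respectively $i_-(M)=r(N)$). (g) $X\succcurlyeq Y$ (respectively $X\preccurlyeq Y$) holds for all $X\in\mathcal S$ and $Y\in\mathcal T$ if and only if $i_-(M)=r(A)+r(C)-n$ (respectively $i_+(M)=r(A)+r(C)-n$). -/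

import Mathlib

open scoped Matrix ComplexOrder

/-- `i₊(H)`: the number of positive eigenvalues of the complex matrix `H`, counted with
multiplicity, i.e. the number of roots `z > 0` of its characteristic polynomial (in the order of
`ℂ`, `0 < z` says that `z` is real and positive).  It is used for Hermitian matrices only. -/
noncomputable def posInertia {ι : Type*} [Fintype ι] [DecidableEq ι] (H : Matrix ι ι ℂ) : ℕ :=
  open Classical in (H.charpoly.roots.filter fun z => 0 < z).card

/-- `i₋(H)`: the number of negative eigenvalues of `H`, counted with multiplicity. -/
noncomputable def negInertia {ι : Type*} [Fintype ι] [DecidableEq ι] (H : Matrix ι ι ℂ) : ℕ :=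
  open Classical in (H.charpoly.roots.filter fun z => z < 0).card

/-- In terms of Mathlib's real eigenvalues of a Hermitian matrix. -/
theorem posInertia_eq {ι : Type*} [Fintype ι] [DecidableEq ι] {H : Matrix ι ι ℂ}
    (hH : H.IsHermitian) :
    posInertia H = (Finset.univ.filter fun i => 0 < hH.eigenvalues i).card := by
  classical
  unfold posInertia
  rw [hH.roots_charpoly_eq_eigenvalues, Multiset.filter_map, Multiset.card_map, Finset.card_def]
  simp [Function.comp_def, Finset.filter_val]

theorem negInertia_eq {ι : Type*} [Fintype ι] [DecidableEq ι] {H : Matrix ι ι ℂ}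
    (hH : H.IsHermitian) :
    negInertia H = (Finset.univ.filter fun i => hH.eigenvalues i < 0).card := by
  classical
  unfold negInertia
  rw [hH.roots_charpoly_eq_eigenvalues, Multiset.filter_map, Multiset.card_map, Finset.card_def]
  have key : ∀ x : ℝ, (x : ℂ) < 0 ↔ x < 0 := fun x => by exact_mod_cast Complex.real_lt_real
  simp [Function.comp_def, Finset.filter_val, key]

/-- The set of Hermitian solutions `X` of `A X = B`. -/
def hermSol {m n : ℕ} (A B : Matrix (Fin m) (Fin n) ℂ) : Set (Matrix (Fin n) (Fin n) ℂ) :=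
  {X | X.IsHermitian ∧ A * X = B}

/-- The block matrix `[[A B*, 0, A], [0, -C D*, C], [A*, C*, 0]]`. -/
def matM {m n : ℕ} (A B C D : Matrix (Fin m) (Fin n) ℂ) :
    Matrix ((Fin m ⊕ Fin m) ⊕ Fin n) ((Fin m ⊕ Fin m) ⊕ Fin n) ℂ :=
  Matrix.fromBlocks
    (Matrix.fromBlocks (A * Bᴴ) 0 0 (-(C * Dᴴ))) (Matrix.fromRows A C)
    (Matrix.fromCols Aᴴ Cᴴ) 0

/-- The block matrix `[[A, B], [C, D]]`. -/
def matN {m n : ℕ} (A B C D : Matrix (Fin m) (Fin n) ℂ) :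
    Matrix (Fin m ⊕ Fin m) (Fin n ⊕ Fin n) ℂ :=
  Matrix.fromBlocks A B C D

/-- The matrix `M` is Hermitian, so that its inertia makes sense. -/
theorem matM_isHermitian {m n : ℕ} {A B C D : Matrix (Fin m) (Fin n) ℂ}
    (hS : (hermSol A B).Nonempty) (hT : (hermSol C D).Nonempty) :
    (matM A B C D).IsHermitian := by
  obtain ⟨X, hX, rfl⟩ := hS
  obtain ⟨Y, hY, rfl⟩ := hT
  refine Matrix.IsHermitian.fromBlocks (Matrix.IsHermitian.fromBlocks ?_ (by simp) ?_) ?_ (by simp)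
  · simp [Matrix.IsHermitian, Matrix.conjTranspose_mul, hX.eq, Matrix.mul_assoc]
  · simp [Matrix.IsHermitian, Matrix.conjTranspose_mul, hY.eq, Matrix.mul_assoc]
  · exact Matrix.conjTranspose_fromRows_eq_fromCols_conjTranspose A C

/-!
Write `H = X - Y`, and let `P` and `Q` be the orthogonal projections onto the kernels of `A` and `C`.
The Hermitian matrices `H` that occur are exactly `H₀ + P U P + Q V Q` with `U`, `V` Hermitian, that
is, the Hermitian forms whose values between the row spaces of `A` and `C` (the column spaces of
`Aᴴ` and `Cᴴ`), and between the intersection of these two spaces and everything, are prescribed. Let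
the columns of `W` span this intersection. Then `H W` and `Wᴴ H W` are the same for all `H`.

*Block matrices.* Eliminating with the projection onto the kernel of `[Aᴴ, Cᴴ]` expresses the data in
terms of `W`: with `r = rank [A; C]` one has `rank N = r + rank (H W)`, `i±(M) = r + i±(Wᴴ H W)`,
`rank [A, BAᴴ; C, DAᴴ] = r + rank (A H W)`, likewise with `C`, `AD* - BC* = -A H Cᴴ`, and
`rank W = rank A + rank C - r` (`IsKerProj.rank_fromBlocks`, `IsKerProj.inertia_matM`,
`SpansInf.rank_add_rank_fromRows`).

*Inertia and maximal rank.* Two inequalities hold for all Hermitian `H` and all `W`: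
`i₊(H) ≤ i₊(Wᴴ H W) + n - rank W` and `i₊(H) ≥ rank (H W) - i₋(Wᴴ H W)`
(`IsHermitian.posInertia_add_rank_le`, `IsHermitian.rank_mul_le`). The bounds that they and their
mirror images give for `i±` and for the rank are attained at `H₀ ± t (P + Q)` with `t` large, since
`P + Q` is positive semidefinite with kernel the column space of `W`
(`IsHermitian.exists_extremal_inertia`, which rests on a Finsler-type compactness argument).

*Minimal rank.* The lower bound is Frobenius' inequality applied twice
(`IsHermitian.rank_add_le_of_spansInf`). It is attained in two steps
(`IsHermitian.exists_rank_add_le`): `U` is chosen so that `C H` has the smallest possible rank while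
`C H Cᴴ` has the largest, and then `V` so that `H` has rank `2 rank (C H) - rank (C H Cᴴ)`.

The consequences (a)-(g) are read off from the extremal values.
-/

namespace Matrix

/-! ### Rank and dimension of kernels -/

section Rank

variable {ι κ μ : Type*} [Fintype κ]

theorem finrank_map_add_finrank_inf_ker (f : (κ → ℂ) →ₗ[ℂ] (ι → ℂ)) (N : Submodule ℂ (κ → ℂ)) :
    Module.finrank ℂ (N.map f) + Module.finrank ℂ (N ⊓ LinearMap.ker f : Submodule ℂ (κ → ℂ))
      = Module.finrank ℂ N := by
  have h := (f.domRestrict N).finrank_range_add_finrank_ker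
  rwa [LinearMap.range_domRestrict, LinearMap.ker_domRestrict,
    ← Submodule.finrank_map_subtype_eq, Submodule.map_comap_subtype] at h

theorem rank_add_finrank_ker (B : Matrix ι κ ℂ) :
    B.rank + Module.finrank ℂ (LinearMap.ker B.mulVecLin) = Fintype.card κ := by
  have := B.mulVecLin.finrank_range_add_finrank_ker
  simpa [Matrix.rank] using this

theorem rank_neg (B : Matrix ι κ ℂ) : (-B).rank = B.rank := by
  have h : (-B).mulVecLin = -B.mulVecLin := by
    ext
    simp
  rw [Matrix.rank, h, LinearMap.range_neg, Matrix.rank]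

theorem rank_add_rank_le_rank_mul_add_card [Fintype ι] (H : Matrix μ ι ℂ) (B : Matrix ι κ ℂ) :
    H.rank + B.rank ≤ (H * B).rank + Fintype.card ι := by
  have h1 := finrank_map_add_finrank_inf_ker H.mulVecLin (LinearMap.range B.mulVecLin)
  rw [← LinearMap.range_comp, ← mulVecLin_mul] at h1
  have h2 := rank_add_finrank_ker H
  have h3 : Module.finrank ℂ (LinearMap.range B.mulVecLin ⊓ LinearMap.ker H.mulVecLin :
    Submodule ℂ (ι → ℂ)) ≤ _ := Submodule.finrank_mono inf_le_right
  simp only [Matrix.rank] at *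
  omega

/-- Setting the coordinates of `V x` selected by `p` to zero imposes at most as many conditions on `x`
as there are such coordinates. -/
theorem card_le_finrank_ker_submatrix [Fintype ι] (V : Matrix ι ι ℂ) (p : ι → Prop) [DecidablePred p] :
    Fintype.card ι ≤ Module.finrank ℂ
        (LinearMap.ker (V.submatrix (Subtype.val : {i // p i} → ι) id).mulVecLin)
      + (Finset.univ.filter p).card := by
  have h1 := (V.submatrix (Subtype.val : {i // p i} → ι) id).mulVecLin.finrank_range_add_finrank_ker
  have h2 := rank_le_card_height (V.submatrix (Subtype.val : {i // p i} → ι) id)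
  rw [Matrix.rank] at h2
  have h3 : Fintype.card {i // p i} = (Finset.univ.filter p).card := Fintype.card_subtype p
  simp only [Module.finrank_fintype_fun_eq_card] at h1
  omega

end Rank

/-! ### Quadratic forms and inertia -/

section Inertia

variable {ι κ : Type*} [Fintype ι] [Fintype κ]

/-- The real quadratic form `x ↦ Re (x* H x)` of a complex matrix. -/
noncomputable def quadRe (H : Matrix ι ι ℂ) (x : ι → ℂ) : ℝ :=
  (star x ⬝ᵥ (H *ᵥ x)).re

theorem quadRe_conj (H : Matrix ι ι ℂ) (B : Matrix ι κ ℂ) (z : κ → ℂ) :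
    quadRe (Bᴴ * H * B) z = quadRe H (B *ᵥ z) := by
  unfold quadRe
  rw [Matrix.mul_assoc, ← mulVec_mulVec, ← mulVec_mulVec, dotProduct_mulVec, star_mulVec]

theorem quadRe_neg (H : Matrix ι ι ℂ) (x : ι → ℂ) : quadRe (-H) x = -quadRe H x := by
  simp [quadRe, neg_mulVec]

theorem quadRe_add (G H : Matrix ι ι ℂ) (x : ι → ℂ) :
    quadRe (G + H) x = quadRe G x + quadRe H x := by
  simp [quadRe, add_mulVec]

theorem quadRe_smul (t : ℝ) (H : Matrix ι ι ℂ) (x : ι → ℂ) :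
    quadRe ((t : ℂ) • H) x = t * quadRe H x := by
  simp [quadRe, smul_mulVec]

theorem quadRe_real_smul (t : ℝ) (H : Matrix ι ι ℂ) (x : ι → ℂ) :
    quadRe H ((t : ℂ) • x) = t ^ 2 * quadRe H x := by
  simp [quadRe, mulVec_smul]
  ring

theorem continuous_quadRe (H : Matrix ι ι ℂ) : Continuous (quadRe H) := by
  unfold quadRe
  fun_prop

/-- A complex subspace on which `H` is positive definite meets one on which `H` is nonpositive only
in `0`. -/
theorem finrank_add_finrank_le_of_pos_of_nonpos {H : Matrix ι ι ℂ}
    {P N : Submodule ℂ (ι → ℂ)} (hP : ∀ x ∈ P, x ≠ 0 → 0 < quadRe H x)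
    (hN : ∀ x ∈ N, quadRe H x ≤ 0) :
    Module.finrank ℂ P + Module.finrank ℂ N ≤ Fintype.card ι := by
  have hd : Disjoint P N := by
    rw [Submodule.disjoint_def]
    intro x h1 h2
    by_contra h
    exact absurd (hP x h1 h) (not_lt.2 (hN x h2))
  have := Submodule.finrank_add_finrank_le_of_disjoint hd
  simpa using this

/-- A Finsler-type lemma: if the form of `G` is positive on the nonzero vectors of `R` on which the
nonnegative form of `S` vanishes, then `G + t S` is positive definite on `R` for large `t`. -/
theorem exists_forall_quadRe_add_smul_pos {G S : Matrix ι ι ℂ} {R : Submodule ℂ (ι → ℂ)}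
    (hS : ∀ x, 0 ≤ quadRe S x) (hG : ∀ x ∈ R, x ≠ 0 → quadRe S x = 0 → 0 < quadRe G x) :
    ∃ k : ℕ, ∀ t : ℝ, k ≤ t → ∀ x ∈ R, x ≠ 0 → 0 < quadRe (G + (t : ℂ) • S) x := by
  -- the unit vectors violating positivity for `t = k` form a decreasing sequence of compact sets
  let F : ℕ → Set (ι → ℂ) := fun k =>
    (Metric.sphere 0 1 ∩ R) ∩ {x | quadRe G x + k * quadRe S x ≤ 0}
  by_cases hF : ∃ k, F k = ∅
  · obtain ⟨k, hk⟩ := hF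
    refine ⟨k, fun t ht x hx hx0 => ?_⟩
    have hn : 0 < ‖x‖ := norm_pos_iff.2 hx0
    have hy : ((‖x‖⁻¹ : ℝ) : ℂ) • x ∉ F k := by simp [hk]
    have h1 : 0 < quadRe G (((‖x‖⁻¹ : ℝ) : ℂ) • x) + k * quadRe S (((‖x‖⁻¹ : ℝ) : ℂ) • x) := by
      by_contra h
      refine hy ⟨⟨?_, R.smul_mem _ hx⟩, not_lt.1 h⟩
      simp [norm_smul, hn.ne']
    rw [quadRe_real_smul, quadRe_real_smul] at h1
    have h2 : 0 < (‖x‖⁻¹) ^ 2 * (quadRe G x + k * quadRe S x) := by linarith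
    have h3 := (mul_pos_iff_of_pos_left (by positivity)).1 h2
    rw [quadRe_add, quadRe_smul]
    have := mul_le_mul_of_nonneg_right ht (hS x)
    linarith
  · push Not at hF
    exfalso
    have hc : ∀ k, IsClosed (F k) := fun k =>
      (Metric.isClosed_sphere.inter R.closed_of_finiteDimensional).inter <|
        isClosed_le ((continuous_quadRe G).add (continuous_const.mul (continuous_quadRe S)))
          continuous_const
    obtain ⟨x, hx⟩ := IsCompact.nonempty_iInter_of_sequence_nonempty_isCompact_isClosed F
      (fun k x hx => ⟨hx.1, by
        have h1 : quadRe G x + ((k + 1 : ℕ) : ℝ) * quadRe S x ≤ 0 := hx.2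
        have h2 := hS x
        push_cast at h1
        show quadRe G x + (k : ℝ) * quadRe S x ≤ 0
        linarith⟩)
      (fun k => hF k)
      ((isCompact_sphere (0 : ι → ℂ) 1).of_isClosed_subset (hc 0) fun x hx => hx.1.1) hc
    rw [Set.mem_iInter] at hx
    have hle : ∀ k : ℕ, quadRe G x + k * quadRe S x ≤ 0 := fun k => (hx k).2
    have hS0 : quadRe S x = 0 := by
      by_contra hne
      have hpos : 0 < quadRe S x := lt_of_le_of_ne (hS x) (Ne.symm hne)
      obtain ⟨k, hk⟩ := exists_nat_gt (-quadRe G x / quadRe S x)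
      rw [div_lt_iff₀ hpos] at hk
      linarith [hle k]
    have hx0 : x ≠ 0 := by
      rintro rfl
      simpa using (hx 0).1.1
    have := hG x (hx 0).1.2 hx0 hS0
    have := hle 0
    simp at this
    linarith

variable [DecidableEq ι] [DecidableEq κ]

theorem IsHermitian.exists_unitary_diagonalization {H : Matrix ι ι ℂ} (hH : H.IsHermitian) :
    ∃ U : Matrix ι ι ℂ, U * Uᴴ = 1 ∧ Uᴴ * U = 1 ∧
      H = U * diagonal (fun i => (hH.eigenvalues i : ℂ)) * Uᴴ := by
  refine ⟨hH.eigenvectorUnitary, ?_, ?_, ?_⟩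
  · exact Unitary.coe_mul_star_self hH.eigenvectorUnitary
  · exact Unitary.coe_star_mul_self hH.eigenvectorUnitary
  · conv_lhs => rw [hH.spectral_theorem, Unitary.conjStarAlgAut_apply]
    rfl

theorem quadRe_diagonal (d : ι → ℝ) (y : ι → ℂ) :
    quadRe (diagonal fun i => (d i : ℂ)) y = ∑ i, d i * Complex.normSq (y i) := by
  simp only [quadRe, dotProduct, mulVec_diagonal, Pi.star_apply, Complex.re_sum]
  refine Finset.sum_congr rfl fun i _ => ?_
  simp [Complex.normSq_apply]
  ring

/-- The spectral subspace of the positive eigenvalues. -/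
theorem IsHermitian.exists_posDef_subspace {H : Matrix ι ι ℂ} (hH : H.IsHermitian) :
    ∃ P : Submodule ℂ (ι → ℂ), posInertia H ≤ Module.finrank ℂ P ∧
      ∀ x ∈ P, x ≠ 0 → 0 < quadRe H x := by
  obtain ⟨U, hU, hU', hd⟩ := hH.exists_unitary_diagonalization
  refine ⟨LinearMap.ker
      (Uᴴ.submatrix (Subtype.val : {i // ¬ 0 < hH.eigenvalues i} → ι) id).mulVecLin, ?_, ?_⟩
  · have h1 := card_le_finrank_ker_submatrix Uᴴ (fun i => ¬ 0 < hH.eigenvalues i)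
    have h2 := Finset.card_filter_add_card_filter_not (s := (Finset.univ : Finset ι))
      (fun i => 0 < hH.eigenvalues i)
    rw [posInertia_eq hH]
    rw [Finset.card_univ] at h2
    omega
  · intro x hx hx0
    have hy : ∀ i, ¬ 0 < hH.eigenvalues i → (Uᴴ *ᵥ x) i = 0 := fun i hi =>
      congrFun (LinearMap.mem_ker.1 hx) ⟨i, hi⟩
    have hq : quadRe H x = quadRe (diagonal fun i => (hH.eigenvalues i : ℂ)) (Uᴴ *ᵥ x) := by
      rw [← quadRe_conj, conjTranspose_conjTranspose, ← hd]
    rw [hq, quadRe_diagonal]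
    have hne : Uᴴ *ᵥ x ≠ 0 := fun h => hx0 <| by
      rw [← one_mulVec x, ← hU, ← mulVec_mulVec, h, mulVec_zero]
    obtain ⟨i, hi⟩ := Function.ne_iff.1 hne
    refine Finset.sum_pos' (fun j _ => ?_) ⟨i, Finset.mem_univ i, ?_⟩
    · by_cases hj : 0 < hH.eigenvalues j
      · exact mul_nonneg hj.le (Complex.normSq_nonneg _)
      · simp [hy j hj]
    · have hi' : 0 < hH.eigenvalues i := by
        by_contra h
        exact hi (hy i h)
      exact mul_pos hi' (Complex.normSq_pos.2 hi)

/-- The spectral subspace of the nonpositive eigenvalues; a vector of it that is isotropic for `H`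
lies in the kernel of `H`. -/
theorem IsHermitian.exists_nonpos_subspace {H : Matrix ι ι ℂ} (hH : H.IsHermitian) :
    ∃ N : Submodule ℂ (ι → ℂ), Fintype.card ι ≤ Module.finrank ℂ N + posInertia H ∧
      ∀ x ∈ N, quadRe H x ≤ 0 ∧ (quadRe H x = 0 → H *ᵥ x = 0) := by
  obtain ⟨U, hU, hU', hd⟩ := hH.exists_unitary_diagonalization
  refine ⟨LinearMap.ker
      (Uᴴ.submatrix (Subtype.val : {i // 0 < hH.eigenvalues i} → ι) id).mulVecLin, ?_, ?_⟩
  · have h1 := card_le_finrank_ker_submatrix Uᴴ (fun i => 0 < hH.eigenvalues i)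
    rwa [posInertia_eq hH]
  · intro x hx
    have hy : ∀ i, 0 < hH.eigenvalues i → (Uᴴ *ᵥ x) i = 0 := fun i hi =>
      congrFun (LinearMap.mem_ker.1 hx) ⟨i, hi⟩
    have hq : quadRe H x = quadRe (diagonal fun i => (hH.eigenvalues i : ℂ)) (Uᴴ *ᵥ x) := by
      rw [← quadRe_conj, conjTranspose_conjTranspose, ← hd]
    rw [hq, quadRe_diagonal]
    have hle : ∀ j ∈ Finset.univ, hH.eigenvalues j * Complex.normSq ((Uᴴ *ᵥ x) j) ≤ 0 := by
      intro j _
      by_cases hj : 0 < hH.eigenvalues j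
      · simp [hy j hj]
      · exact mul_nonpos_of_nonpos_of_nonneg (not_lt.1 hj) (Complex.normSq_nonneg _)
    refine ⟨Finset.sum_nonpos hle, fun h0 => ?_⟩
    rw [Finset.sum_eq_zero_iff_of_nonpos hle] at h0
    have : diagonal (fun i => (hH.eigenvalues i : ℂ)) *ᵥ (Uᴴ *ᵥ x) = 0 := by
      funext j
      rw [mulVec_diagonal]
      have := h0 j (Finset.mem_univ j)
      rw [mul_eq_zero, Complex.normSq_eq_zero] at this
      rcases this with h | h <;> simp [h]
    rw [hd, ← mulVec_mulVec, ← mulVec_mulVec, this, mulVec_zero]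

/-- Together with `exists_posDef_subspace`, the variational description of `i₊(H)` as the largest
dimension of a subspace on which `H` is positive definite. -/
theorem IsHermitian.finrank_le_posInertia {H : Matrix ι ι ℂ} (hH : H.IsHermitian)
    {P : Submodule ℂ (ι → ℂ)} (hP : ∀ x ∈ P, x ≠ 0 → 0 < quadRe H x) :
    Module.finrank ℂ P ≤ posInertia H := by
  obtain ⟨N, hN, hN'⟩ := hH.exists_nonpos_subspace
  have := finrank_add_finrank_le_of_pos_of_nonpos hP fun x hx => (hN' x hx).1
  omega

theorem IsHermitian.finrank_add_posInertia_le {H : Matrix ι ι ℂ} (hH : H.IsHermitian)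
    {N : Submodule ℂ (ι → ℂ)} (hN : ∀ x ∈ N, quadRe H x ≤ 0) :
    Module.finrank ℂ N + posInertia H ≤ Fintype.card ι := by
  obtain ⟨P, hP, hP'⟩ := hH.exists_posDef_subspace
  have := finrank_add_finrank_le_of_pos_of_nonpos hP' hN
  omega

theorem IsHermitian.posInertia_neg {H : Matrix ι ι ℂ} (hH : H.IsHermitian) :
    posInertia (-H) = negInertia H := by
  classical
  obtain ⟨U, hU, hU', hd⟩ := hH.exists_unitary_diagonalization
  have hc : (-H).charpoly = ∏ i, (Polynomial.X - Polynomial.C (-(hH.eigenvalues i : ℂ))) := by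
    have : -H = U * diagonal (fun i => -(hH.eigenvalues i : ℂ)) * Uᴴ := by
      conv_lhs => rw [hd]
      rw [← Matrix.neg_mul, ← Matrix.mul_neg, diagonal_neg]
    rw [this, charpoly_mul_comm, ← Matrix.mul_assoc, hU', Matrix.one_mul, charpoly_diagonal]
  have hr : (-H).charpoly.roots
      = Multiset.map (fun i => -(hH.eigenvalues i : ℂ)) Finset.univ.val := by
    rw [hc, Polynomial.roots_prod]
    · simp [-map_neg]
    · simp only [Finset.prod_ne_zero_iff, ne_eq]
      exact fun i _ => Polynomial.X_sub_C_ne_zero _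
  have key : ∀ x : ℝ, 0 < -(x : ℂ) ↔ x < 0 := fun x => by
    rw [neg_pos]; exact_mod_cast Complex.real_lt_real
  rw [negInertia_eq hH, posInertia, hr, Multiset.filter_map, Multiset.card_map, Finset.card_def]
  simp only [Function.comp_def, Finset.filter_val, key]

theorem IsHermitian.negInertia_neg {H : Matrix ι ι ℂ} (hH : H.IsHermitian) :
    negInertia (-H) = posInertia H := by
  rw [← hH.neg.posInertia_neg, neg_neg]

theorem IsHermitian.posInertia_add_negInertia {H : Matrix ι ι ℂ} (hH : H.IsHermitian) :
    posInertia H + negInertia H = H.rank := by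
  classical
  rw [hH.rank_eq_card_non_zero_eigs, posInertia_eq hH, negInertia_eq hH, Fintype.card_subtype,
    ← Finset.card_union_of_disjoint]
  · congr 1
    ext i
    simp only [Finset.mem_filter_univ, Finset.mem_union]
    exact or_comm.trans lt_or_lt_iff_ne
  · rw [Finset.disjoint_filter]
    intro i _ h1 h2
    exact absurd h1 h2.not_gt

theorem IsHermitian.posDef_iff_posInertia_eq {H : Matrix ι ι ℂ} (hH : H.IsHermitian) :
    H.PosDef ↔ posInertia H = Fintype.card ι := by
  rw [hH.posDef_iff_eigenvalues_pos, posInertia_eq hH, ← Finset.card_univ,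
    Finset.card_filter_eq_iff]
  simp

theorem IsHermitian.posSemidef_iff_negInertia_eq_zero {H : Matrix ι ι ℂ} (hH : H.IsHermitian) :
    H.PosSemidef ↔ negInertia H = 0 := by
  rw [hH.posSemidef_iff_eigenvalues_nonneg, negInertia_eq hH, Finset.card_eq_zero,
    Finset.filter_eq_empty_iff]
  simp [Pi.le_def]

/-- Interlacing: passing from the restriction of `H` to the column space of `B` to `H` itself raises
the number of positive eigenvalues by at most the codimension. -/
theorem IsHermitian.posInertia_add_rank_le {H : Matrix ι ι ℂ} (hH : H.IsHermitian)
    (B : Matrix ι κ ℂ) :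
    posInertia H + B.rank ≤ posInertia (Bᴴ * H * B) + Fintype.card ι := by
  obtain ⟨N, hN, hN'⟩ := (isHermitian_conjTranspose_mul_mul B hH).exists_nonpos_subspace
  have h1 : ∀ x ∈ N.map B.mulVecLin, quadRe H x ≤ 0 := by
    rintro _ ⟨z, hz, rfl⟩
    have := (hN' z hz).1
    rwa [quadRe_conj] at this
  have h2 := hH.finrank_add_posInertia_le h1
  have h3 := finrank_map_add_finrank_inf_ker B.mulVecLin N
  have h5 : Module.finrank ℂ (N ⊓ LinearMap.ker B.mulVecLin : Submodule ℂ (κ → ℂ)) ≤ _ :=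
    Submodule.finrank_mono inf_le_right
  have h4 := rank_add_finrank_ker B
  omega

/-- A positive definite subspace for `Bᴴ H B` is mapped injectively by `B` onto one for `H`. -/
theorem IsHermitian.posInertia_conj_le {H : Matrix ι ι ℂ} (hH : H.IsHermitian)
    (B : Matrix ι κ ℂ) : posInertia (Bᴴ * H * B) ≤ posInertia H := by
  obtain ⟨P, hP, hP'⟩ := (isHermitian_conjTranspose_mul_mul B hH).exists_posDef_subspace
  have hinj : ∀ z ∈ P, B *ᵥ z = 0 → z = 0 := by
    intro z hz h0
    by_contra hne
    have := hP' z hz hne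
    rw [quadRe_conj, h0] at this
    simp [quadRe] at this
  have h1 : ∀ x ∈ P.map B.mulVecLin, x ≠ 0 → 0 < quadRe H x := by
    rintro _ ⟨z, hz, rfl⟩ h0
    have := hP' z hz (by rintro rfl; simp at h0)
    rwa [quadRe_conj] at this
  have h2 := hH.finrank_le_posInertia h1
  have h3 := finrank_map_add_finrank_inf_ker B.mulVecLin P
  have h4 : P ⊓ LinearMap.ker B.mulVecLin = ⊥ :=
    (Submodule.eq_bot_iff _).2 fun z hz => hinj z hz.1 hz.2
  rw [h4, finrank_bot] at h3
  omega

/-- If `H` is nonnegative on `R`, then the vectors of `R` in the nonpositive spectral subspace of `H`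
are isotropic, hence killed by `H`, which bounds the dimension of `H R`. -/
theorem IsHermitian.finrank_map_le_posInertia {H : Matrix ι ι ℂ} (hH : H.IsHermitian)
    {R : Submodule ℂ (ι → ℂ)} (hR : ∀ x ∈ R, 0 ≤ quadRe H x) :
    Module.finrank ℂ (R.map H.mulVecLin) ≤ posInertia H := by
  obtain ⟨N, hN, hN'⟩ := hH.exists_nonpos_subspace
  have h1 := finrank_map_add_finrank_inf_ker H.mulVecLin R
  have h2 : R ⊓ N ≤ R ⊓ LinearMap.ker H.mulVecLin := fun x hx =>
    ⟨hx.1, (hN' x hx.2).2 (le_antisymm (hN' x hx.2).1 (hR x hx.1))⟩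
  have h3 := Submodule.finrank_mono h2
  have h4 := Submodule.finrank_sup_add_finrank_inf_eq R N
  have h5 := (R ⊔ N).finrank_le
  simp only [Module.finrank_fintype_fun_eq_card] at h5
  omega

/-- The lower bound for the number of positive eigenvalues of `H` in terms of its action on the
column space of `B` alone. -/
theorem IsHermitian.rank_mul_le {H : Matrix ι ι ℂ} (hH : H.IsHermitian) (B : Matrix ι κ ℂ) :
    (H * B).rank ≤ posInertia H + negInertia (Bᴴ * H * B) := by
  have ha := isHermitian_conjTranspose_mul_mul B hH
  obtain ⟨T, hT, hT'⟩ := ha.neg.exists_nonpos_subspace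
  rw [ha.posInertia_neg] at hT
  have hR : ∀ x ∈ T.map B.mulVecLin, 0 ≤ quadRe H x := by
    rintro _ ⟨z, hz, rfl⟩
    have := (hT' z hz).1
    rw [quadRe_neg, quadRe_conj] at this
    simpa using this
  have h1 := hH.finrank_map_le_posInertia hR
  rw [← Submodule.map_comp, ← mulVecLin_mul] at h1
  have h2 := finrank_map_add_finrank_inf_ker (H * B).mulVecLin T
  have h3 := rank_add_finrank_ker (H * B)
  have h4 : Module.finrank ℂ (T ⊓ LinearMap.ker (H * B).mulVecLin : Submodule ℂ (κ → ℂ)) ≤ _ :=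
    Submodule.finrank_mono inf_le_right
  omega

/-- For a positive semidefinite `S` vanishing on the column space of `B`, the number of positive
eigenvalues of `G + t S` with large `t` is at least what the block form of `G + t S` with respect
to the kernel and the column space of `S` suggests. -/
theorem IsHermitian.exists_forall_posInertia_add_rank_le {G S : Matrix ι ι ℂ}
    (hG : G.IsHermitian) (hS : S.PosSemidef) {B : Matrix ι κ ℂ} (hSB : S * B = 0) :
    ∃ k : ℕ, ∀ t : ℝ, k ≤ t →
      posInertia (Bᴴ * G * B) + S.rank ≤ posInertia (G + (t : ℂ) • S) := by
  have hSh := hS.isHermitian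
  have hS0 : ∀ x, 0 ≤ quadRe S x := fun x => (Complex.le_def.1 (hS.dotProduct_mulVec_nonneg x)).1
  have hSker : ∀ x, quadRe S x = 0 → S *ᵥ x = 0 := fun x hx => by
    rw [← hS.dotProduct_mulVec_zero_iff]
    refine Complex.ext hx ?_
    exact (Complex.le_def.1 (hS.dotProduct_mulVec_nonneg x)).2.symm
  obtain ⟨P, hP, hP'⟩ := (isHermitian_conjTranspose_mul_mul B hG).exists_posDef_subspace
  have hdisj : ∀ x, S *ᵥ x = 0 → x ∈ LinearMap.range S.mulVecLin → x = 0 := by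
    rintro _ h ⟨y, rfl⟩
    rw [mulVecLin_apply] at h ⊢
    rw [← dotProduct_star_self_eq_zero, star_mulVec, hSh.eq, ← dotProduct_mulVec, h,
      dotProduct_zero]
  have hBP : ∀ x ∈ P.map B.mulVecLin, S *ᵥ x = 0 := by
    rintro _ ⟨z, -, rfl⟩
    rw [mulVecLin_apply, mulVec_mulVec, hSB, zero_mulVec]
  have hBG : ∀ x ∈ P.map B.mulVecLin, x ≠ 0 → 0 < quadRe G x := by
    rintro _ ⟨z, hz, rfl⟩ h0
    have := hP' z hz (by rintro rfl; simp at h0)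
    rwa [quadRe_conj] at this
  obtain ⟨k, hk⟩ := exists_forall_quadRe_add_smul_pos (G := G) (S := S)
    (R := P.map B.mulVecLin ⊔ LinearMap.range S.mulVecLin) hS0 (by
      intro x hx hx0 hxS
      obtain ⟨b, hb, s, hs, rfl⟩ := Submodule.mem_sup.1 hx
      have h1 := hSker _ hxS
      rw [mulVec_add, hBP b hb, zero_add] at h1
      have h2 := hdisj s h1 hs
      subst h2
      rw [add_zero] at hx0 ⊢
      exact hBG b hb hx0)
  refine ⟨k, fun t ht => ?_⟩
  have hHt : (G + (t : ℂ) • S).IsHermitian := by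
    refine hG.add ?_
    simp [IsHermitian, conjTranspose_smul, hSh.eq]
  have h1 := hHt.finrank_le_posInertia (hk t ht)
  have h2 := Submodule.finrank_sup_add_finrank_inf_eq (P.map B.mulVecLin)
    (LinearMap.range S.mulVecLin)
  have h3 : P.map B.mulVecLin ⊓ LinearMap.range S.mulVecLin = ⊥ :=
    (Submodule.eq_bot_iff _).2 fun x hx => hdisj x (hBP x hx.1) hx.2
  rw [h3, finrank_bot] at h2
  have h4 := finrank_map_add_finrank_inf_ker B.mulVecLin P
  have h5 : P ⊓ LinearMap.ker B.mulVecLin = ⊥ := (Submodule.eq_bot_iff _).2 fun z hz => by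
    by_contra hne
    have := hP' z hz.1 hne
    rw [quadRe_conj, show B *ᵥ z = 0 from hz.2] at this
    simp [quadRe] at this
  rw [h5, finrank_bot] at h4
  rw [Matrix.rank]
  omega

/-- The rank version, for `G` of any inertia: add the lower bounds for the numbers of positive and of
negative eigenvalues of `G + t S`, in which the inertia of `Bᴴ G B` cancels. -/
theorem IsHermitian.exists_forall_rank_add_rank_le {G S : Matrix ι ι ℂ}
    (hG : G.IsHermitian) (hS : S.PosSemidef) {B : Matrix ι κ ℂ} (hSB : S * B = 0) :
    ∃ k : ℕ, ∀ t : ℝ, k ≤ t → S.rank + (G * B).rank ≤ (G + (t : ℂ) • S).rank := by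
  obtain ⟨k, hk⟩ := hG.exists_forall_posInertia_add_rank_le hS hSB
  refine ⟨k, fun t ht => ?_⟩
  have hHt : (G + (t : ℂ) • S).IsHermitian := by
    refine hG.add ?_
    simp [IsHermitian, conjTranspose_smul, hS.isHermitian.eq]
  have h1 := hk t ht
  have h2 := hHt.neg.rank_mul_le B
  have h3 : (G + (t : ℂ) • S) * B = G * B := by simp [Matrix.add_mul, hSB]
  have h4 := isHermitian_conjTranspose_mul_mul B hHt
  rw [hHt.posInertia_neg, Matrix.neg_mul, rank_neg, Matrix.mul_neg, Matrix.neg_mul,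
    h4.negInertia_neg, Matrix.mul_assoc, h3, ← Matrix.mul_assoc] at h2
  have h5 := hHt.posInertia_add_negInertia
  omega

end Inertia

/-! ### Rank inequalities -/

section RankInequalities

variable {ι κ μ ν : Type*} [Fintype ι] [Fintype κ]

theorem range_mulVecLin_mul (X : Matrix ν ι ℂ) (Y : Matrix ι κ ℂ) :
    LinearMap.range (X * Y).mulVecLin = (LinearMap.range Y.mulVecLin).map X.mulVecLin := by
  rw [mulVecLin_mul, LinearMap.range_comp]

theorem range_mulVecLin_fromCols (E : Matrix ν ι ℂ) (F : Matrix ν κ ℂ) :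
    LinearMap.range (fromCols E F).mulVecLin
      = LinearMap.range E.mulVecLin ⊔ LinearMap.range F.mulVecLin := by
  apply le_antisymm
  · rintro _ ⟨v, rfl⟩
    rw [mulVecLin_apply, fromCols_mulVec]
    exact Submodule.add_mem_sup ⟨_, rfl⟩ ⟨_, rfl⟩
  · refine sup_le ?_ ?_
    · rintro _ ⟨v, rfl⟩
      exact ⟨Sum.elim v 0, by simp [fromCols_mulVec]⟩
    · rintro _ ⟨v, rfl⟩
      exact ⟨Sum.elim 0 v, by simp [fromCols_mulVec]⟩

theorem rank_add_le [Finite ν] (X Y : Matrix ν ι ℂ) : (X + Y).rank ≤ X.rank + Y.rank := by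
  have := Fintype.ofFinite ν
  have h : LinearMap.range (X + Y).mulVecLin
      ≤ LinearMap.range X.mulVecLin ⊔ LinearMap.range Y.mulVecLin := by
    rw [mulVecLin_add]
    exact LinearMap.range_add_le _ _
  exact (Submodule.finrank_mono h).trans (Submodule.finrank_add_le_finrank_add_finrank _ _)

/-- Frobenius' rank inequality. -/
theorem rank_mul_add_rank_mul_le [Fintype μ] (X : Matrix ν ι ℂ) (Y : Matrix ι κ ℂ)
    (Z : Matrix κ μ ℂ) :
    (X * Y).rank + (Y * Z).rank ≤ Y.rank + (X * Y * Z).rank := by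
  have h1 := finrank_map_add_finrank_inf_ker X.mulVecLin (LinearMap.range Y.mulVecLin)
  have h2 := finrank_map_add_finrank_inf_ker X.mulVecLin (LinearMap.range (Y * Z).mulVecLin)
  rw [← range_mulVecLin_mul] at h1 h2
  have h3 : LinearMap.range (Y * Z).mulVecLin ≤ LinearMap.range Y.mulVecLin := by
    rw [mulVecLin_mul]
    exact LinearMap.range_comp_le_range _ _
  have h4 := Submodule.finrank_mono (inf_le_inf_right (LinearMap.ker X.mulVecLin) h3)
  rw [Matrix.mul_assoc X Y Z]
  simp only [Matrix.rank]
  omega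

/-- If `K` maps the kernel of `F` into the image of `K * Γ`, then modulo the column space of `Γ` the
rank of `K` is at most that of `F`. -/
theorem rank_add_rank_mul_le_of_ker {τ : Type*} [Fintype τ] {K : Matrix μ κ ℂ} {F : Matrix ν κ ℂ}
    {Γ : Matrix κ τ ℂ} (h : ∀ y, F *ᵥ y = 0 → ∃ s, K *ᵥ y = (K * Γ) *ᵥ s) :
    K.rank + (F * Γ).rank ≤ (K * Γ).rank + F.rank := by
  set Y := LinearMap.range Γ.mulVecLin ⊔ LinearMap.ker F.mulVecLin with hY
  have h1 := finrank_map_add_finrank_inf_ker F.mulVecLin Y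
  have h2 : Y.map F.mulVecLin = LinearMap.range (F * Γ).mulVecLin := by
    rw [hY, Submodule.map_sup, range_mulVecLin_mul, sup_eq_left, Submodule.map_le_iff_le_comap]
    exact (LinearMap.ker_le_comap _)
  have h3 : Y ⊓ LinearMap.ker F.mulVecLin = LinearMap.ker F.mulVecLin :=
    inf_eq_right.2 le_sup_right
  have h4 := rank_add_finrank_ker F
  have h5 := finrank_map_add_finrank_inf_ker K.mulVecLin Y
  have h6 : Y.map K.mulVecLin ≤ LinearMap.range (K * Γ).mulVecLin := by
    rw [hY, Submodule.map_sup, ← range_mulVecLin_mul]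
    refine sup_le le_rfl ?_
    rintro _ ⟨y, hy, rfl⟩
    obtain ⟨s, hs⟩ := h y hy
    exact ⟨s, hs.symm⟩
  have h7 := Submodule.finrank_mono h6
  have h8 : Module.finrank ℂ (Y ⊓ LinearMap.ker K.mulVecLin : Submodule ℂ (κ → ℂ)) ≤ _ :=
    Submodule.finrank_mono inf_le_right
  have h9 := rank_add_finrank_ker K
  rw [h2, h3] at h1
  simp only [Matrix.rank] at *
  omega

end RankInequalities

/-! ### Orthogonal projections onto kernels -/

section Projection

variable {ι κ μ : Type*} [Fintype ι] [DecidableEq ι]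

/-- The Moore–Penrose inverse of a Hermitian matrix. -/
theorem IsHermitian.exists_pseudoinverse {H : Matrix ι ι ℂ} (hH : H.IsHermitian) :
    ∃ g : Matrix ι ι ℂ, g.IsHermitian ∧ H * g * H = H ∧ g * H * g = g ∧ g * H = H * g := by
  obtain ⟨U, -, hU, hd⟩ := hH.exists_unitary_diagonalization
  set d : ι → ℂ := fun i => (hH.eigenvalues i : ℂ) with hdd
  have key : ∀ a b : ι → ℂ, (U * diagonal a * Uᴴ) * (U * diagonal b * Uᴴ)
      = U * diagonal (fun i => a i * b i) * Uᴴ := by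
    intro a b
    calc _ = U * diagonal a * (Uᴴ * U) * diagonal b * Uᴴ := by simp only [Matrix.mul_assoc]
      _ = _ := by rw [hU, Matrix.mul_one, Matrix.mul_assoc U, diagonal_mul_diagonal]
  refine ⟨U * diagonal (fun i => (d i)⁻¹) * Uᴴ, ?_, ?_, ?_, ?_⟩
  · refine isHermitian_mul_mul_conjTranspose _ ?_
    rw [IsHermitian, diagonal_conjTranspose]
    congr 1
    ext i
    simp [hdd]
  · rw [hd, key, key]
    simp [mul_inv_mul_cancel]
  · rw [hd, key, key]
    congr 3
    ext i
    by_cases h : d i = 0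
    · simp [h]
    · field_simp
  · rw [hd, key, key]
    simp only [mul_comm]

/-- `P` is the orthogonal projection onto the kernel of `A`. The last condition says that the
complementary projection `1 - P` factors through `A`. -/
structure IsKerProj [Fintype κ] (A : Matrix κ ι ℂ) (P : Matrix ι ι ℂ) : Prop where
  isHermitian : P.IsHermitian
  mul_self : P * P = P
  mul_eq_zero : A * P = 0
  exists_one_sub : ∃ Z : Matrix ι κ ℂ, 1 - P = Z * A

theorem exists_isKerProj [Fintype κ] (A : Matrix κ ι ℂ) : ∃ P, IsKerProj A P := by
  have hG := isHermitian_conjTranspose_mul_self A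
  obtain ⟨g, hg, h1, h2, h3⟩ := hG.exists_pseudoinverse
  have hgG : (g * (Aᴴ * A)).IsHermitian := by
    rw [IsHermitian, conjTranspose_mul, hg.eq, hG.eq, h3]
  refine ⟨1 - g * (Aᴴ * A), isHermitian_one.sub hgG, ?_, ?_, g * Aᴴ, ?_⟩
  · have h4 : g * (Aᴴ * A) * (g * (Aᴴ * A)) = g * (Aᴴ * A) := by rw [← Matrix.mul_assoc, h2]
    rw [Matrix.mul_sub, Matrix.mul_one, Matrix.sub_mul, Matrix.one_mul, h4, sub_self, sub_zero]
  · rw [← conjTranspose_mul_self_mul_eq_zero, Matrix.mul_sub, Matrix.mul_one, ← Matrix.mul_assoc,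
      h1, sub_self]
  · rw [sub_sub_cancel, Matrix.mul_assoc]

namespace IsKerProj

variable [Fintype κ] {A : Matrix κ ι ℂ} {P : Matrix ι ι ℂ}

theorem posSemidef (hP : IsKerProj A P) : P.PosSemidef := by
  have := posSemidef_conjTranspose_mul_self P
  rwa [hP.isHermitian.eq, hP.mul_self] at this

theorem mul_conjTranspose (hP : IsKerProj A P) : P * Aᴴ = 0 := by
  have := congrArg conjTranspose hP.mul_eq_zero
  rwa [conjTranspose_mul, hP.isHermitian.eq, conjTranspose_zero] at this

theorem exists_one_sub_eq_conjTranspose_mul (hP : IsKerProj A P) :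
    ∃ Z : Matrix κ ι ℂ, 1 - P = Aᴴ * Z := by
  obtain ⟨Z, hZ⟩ := hP.exists_one_sub
  refine ⟨Zᴴ, ?_⟩
  rw [← conjTranspose_mul, ← hZ, conjTranspose_sub, conjTranspose_one, hP.isHermitian.eq]

theorem mul_eq_self (hP : IsKerProj A P) {X : Matrix ι μ ℂ} (hX : A * X = 0) : P * X = X := by
  obtain ⟨Z, hZ⟩ := hP.exists_one_sub
  have : (1 - P) * X = 0 := by rw [hZ, Matrix.mul_assoc, hX, Matrix.mul_zero]
  rw [Matrix.sub_mul, Matrix.one_mul, sub_eq_zero] at this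
  exact this.symm

theorem mulVec_eq_self (hP : IsKerProj A P) {x : ι → ℂ} (hx : A *ᵥ x = 0) : P *ᵥ x = x := by
  obtain ⟨Z, hZ⟩ := hP.exists_one_sub
  have : (1 - P) *ᵥ x = 0 := by rw [hZ, ← mulVec_mulVec, hx, mulVec_zero]
  rw [sub_mulVec, one_mulVec, sub_eq_zero] at this
  exact this.symm

theorem exists_eq_conjTranspose_mulVec (hP : IsKerProj A P) {x : ι → ℂ} (hx : P *ᵥ x = 0) :
    ∃ u, x = Aᴴ *ᵥ u := by
  obtain ⟨Z, hZ⟩ := hP.exists_one_sub_eq_conjTranspose_mul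
  refine ⟨Z *ᵥ x, ?_⟩
  rw [mulVec_mulVec, ← hZ, sub_mulVec, hx, one_mulVec, sub_zero]

/-- The rank of `[E, F]`, where `Γ` projects onto the orthogonal complement of the column space
of `E`. -/
theorem rank_fromCols [DecidableEq κ] [Fintype μ] {E : Matrix ι κ ℂ} {Γ : Matrix ι ι ℂ}
    (hΓ : IsKerProj Eᴴ Γ) (F : Matrix ι μ ℂ) :
    (fromCols E F).rank = E.rank + (Γ * F).rank := by
  have h := finrank_map_add_finrank_inf_ker Γ.mulVecLin (LinearMap.range (fromCols E F).mulVecLin)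
  have hE : Γ * E = 0 := by simpa using hΓ.mul_conjTranspose
  have h1 : (LinearMap.range (fromCols E F).mulVecLin).map Γ.mulVecLin
      = LinearMap.range (Γ * F).mulVecLin := by
    rw [← range_mulVecLin_mul, mul_fromCols, hE, range_mulVecLin_fromCols]
    simp
  have h2 : LinearMap.range (fromCols E F).mulVecLin ⊓ LinearMap.ker Γ.mulVecLin
      = LinearMap.range E.mulVecLin := by
    apply le_antisymm
    · rintro x ⟨-, hx⟩
      obtain ⟨u, hu⟩ := hΓ.exists_eq_conjTranspose_mulVec hx
      exact ⟨u, by simpa using hu.symm⟩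
    · rw [range_mulVecLin_fromCols]
      refine le_inf le_sup_left ?_
      rintro _ ⟨u, rfl⟩
      simp [hE]
  rw [h1, h2] at h
  simp only [Matrix.rank]
  omega

end IsKerProj

end Projection

/-! ### The inertia of a bordered Hermitian matrix -/

section BorderedInertia

variable {ι κ : Type*}

theorem isHermitian_fromBlocks_zero {G : Matrix ι ι ℂ} (hG : G.IsHermitian) (E : Matrix ι κ ℂ) :
    (fromBlocks G E Eᴴ 0).IsHermitian :=
  hG.fromBlocks rfl isHermitian_zero

variable [Fintype ι] [DecidableEq ι] [Fintype κ] [DecidableEq κ]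

theorem fromBlocks_mul_fromBlocks_isKerProj {E : Matrix ι κ ℂ} {Γ : Matrix ι ι ℂ}
    (hΓ : IsKerProj Eᴴ Γ) (G : Matrix ι ι ℂ) :
    fromBlocks G E Eᴴ 0 * fromBlocks Γ 0 0 (1 : Matrix κ κ ℂ)
      = fromRows (fromCols (G * Γ) E) 0 := by
  rw [fromBlocks_multiply, hΓ.mul_eq_zero]
  ext (i | i) (j | j) <;> simp

theorem rank_fromBlocks_mul_fromBlocks_isKerProj {E : Matrix ι κ ℂ} {Γ : Matrix ι ι ℂ}
    (hΓ : IsKerProj Eᴴ Γ) (G : Matrix ι ι ℂ) :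
    (fromBlocks G E Eᴴ 0 * fromBlocks Γ 0 0 (1 : Matrix κ κ ℂ)).rank
      = E.rank + (Γ * G * Γ).rank := by
  have h1 : (fromCols (G * Γ) E).rank = E.rank + (Γ * G * Γ).rank := by
    rw [Matrix.mul_assoc, ← hΓ.rank_fromCols]
    rw [Matrix.rank, Matrix.rank, range_mulVecLin_fromCols, range_mulVecLin_fromCols, sup_comm]
  rw [fromBlocks_mul_fromBlocks_isKerProj hΓ, ← h1]
  apply le_antisymm
  · have := Matrix.rank_mul_le_right (fromRows (1 : Matrix ι ι ℂ) (0 : Matrix κ ι ℂ))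
      (fromCols (G * Γ) E)
    rwa [fromRows_mul, Matrix.one_mul, Matrix.zero_mul] at this
  · have := Matrix.rank_mul_le_right (fromCols (1 : Matrix ι ι ℂ) (0 : Matrix ι κ ℂ))
      (fromRows (fromCols (G * Γ) E) 0)
    rwa [fromCols_mul_fromRows, Matrix.one_mul, Matrix.zero_mul, add_zero] at this

/-- The half `≥` of `inertia_fromBlocks_zero`: the general lower bound, applied to the subspace
`ker Eᴴ ⊕ ℂ^κ`, on which the bordered form is that of `G` on `ker Eᴴ`. -/
theorem rank_add_posInertia_le_fromBlocks {G : Matrix ι ι ℂ} (hG : G.IsHermitian)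
    {E : Matrix ι κ ℂ} {Γ : Matrix ι ι ℂ} (hΓ : IsKerProj Eᴴ Γ) :
    E.rank + posInertia (Γ * G * Γ) ≤ posInertia (fromBlocks G E Eᴴ 0) := by
  have hM := isHermitian_fromBlocks_zero hG E
  have h1 := hM.rank_mul_le (fromBlocks Γ 0 0 (1 : Matrix κ κ ℂ))
  rw [rank_fromBlocks_mul_fromBlocks_isKerProj hΓ] at h1
  have ha : (Γ * G * Γ).IsHermitian := by
    simpa [hΓ.isHermitian.eq] using isHermitian_conjTranspose_mul_mul Γ hG
  have h2 : (fromBlocks Γ 0 0 (1 : Matrix κ κ ℂ))ᴴ * fromBlocks G E Eᴴ 0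
        * fromBlocks Γ 0 0 (1 : Matrix κ κ ℂ)
      = (fromCols (1 : Matrix ι ι ℂ) (0 : Matrix ι κ ℂ))ᴴ * (Γ * G * Γ)
        * fromCols (1 : Matrix ι ι ℂ) (0 : Matrix ι κ ℂ) := by
    have hE : Γ * E = 0 := by simpa using hΓ.mul_conjTranspose
    rw [Matrix.mul_assoc, fromBlocks_mul_fromBlocks_isKerProj hΓ, fromBlocks_conjTranspose,
      conjTranspose_fromCols_eq_fromRows_conjTranspose, hΓ.isHermitian.eq, Matrix.mul_assoc,
      mul_fromCols, fromRows_mul_fromCols]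
    ext (i | i) (j | j) <;> simp [fromBlocks_mul_fromRows, hE, mul_fromCols, Matrix.mul_assoc]
  have h3 := ha.neg.posInertia_conj_le (fromCols (1 : Matrix ι ι ℂ) (0 : Matrix ι κ ℂ))
  rw [Matrix.mul_neg, Matrix.neg_mul, ← h2,
    (isHermitian_conjTranspose_mul_mul _ hM).posInertia_neg, ha.posInertia_neg] at h3
  have h4 := ha.posInertia_add_negInertia
  omega

theorem rank_fromBlocks_le {G : Matrix ι ι ℂ}
    {E : Matrix ι κ ℂ} {Γ : Matrix ι ι ℂ} (hΓ : IsKerProj Eᴴ Γ) :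
    (fromBlocks G E Eᴴ 0).rank ≤ 2 * E.rank + (Γ * G * Γ).rank := by
  have h1 := rank_add_rank_le_rank_mul_add_card (fromBlocks G E Eᴴ 0)
    (fromBlocks Γ 0 0 (1 : Matrix κ κ ℂ))
  rw [rank_fromBlocks_mul_fromBlocks_isKerProj hΓ] at h1
  obtain ⟨Z, hZ⟩ := hΓ.exists_one_sub_eq_conjTranspose_mul
  rw [conjTranspose_conjTranspose] at hZ
  have h2 : (1 : Matrix (ι ⊕ κ) (ι ⊕ κ) ℂ) = fromBlocks Γ 0 0 (1 : Matrix κ κ ℂ)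
      + fromRows (1 : Matrix ι ι ℂ) (0 : Matrix κ ι ℂ) * E
        * (Z * fromCols (1 : Matrix ι ι ℂ) (0 : Matrix ι κ ℂ)) := by
    rw [Matrix.mul_assoc, ← Matrix.mul_assoc E, ← hZ, mul_fromCols, fromRows_mul_fromCols,
      ← fromBlocks_one]
    ext (i | i) (j | j) <;> simp
  have h3 := rank_add_le (fromBlocks Γ 0 0 (1 : Matrix κ κ ℂ))
    (fromRows (1 : Matrix ι ι ℂ) (0 : Matrix κ ι ℂ) * E
        * (Z * fromCols (1 : Matrix ι ι ℂ) (0 : Matrix ι κ ℂ)))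
  rw [← h2, rank_one] at h3
  have h4 := (Matrix.rank_mul_le_left (fromRows (1 : Matrix ι ι ℂ) (0 : Matrix κ ι ℂ) * E)
    (Z * fromCols (1 : Matrix ι ι ℂ) (0 : Matrix ι κ ℂ))).trans (Matrix.rank_mul_le_right _ _)
  omega

/-- The inertia of a Hermitian matrix bordered by `E`: the form of `G` on the kernel of `Eᴴ`,
together with `E.rank` hyperbolic planes. -/
theorem inertia_fromBlocks_zero {G : Matrix ι ι ℂ} (hG : G.IsHermitian)
    {E : Matrix ι κ ℂ} {Γ : Matrix ι ι ℂ} (hΓ : IsKerProj Eᴴ Γ) :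
    posInertia (fromBlocks G E Eᴴ 0) = E.rank + posInertia (Γ * G * Γ) ∧
      negInertia (fromBlocks G E Eᴴ 0) = E.rank + negInertia (Γ * G * Γ) := by
  have hM := isHermitian_fromBlocks_zero hG E
  have ha : (Γ * G * Γ).IsHermitian := by
    simpa [hΓ.isHermitian.eq] using isHermitian_conjTranspose_mul_mul Γ hG
  -- the lower bounds for `i₊` and, passing to `-G` and `-E`, for `i₋` add up to the upper bound for
  -- the rank, so both are equalities
  have hΓ' : IsKerProj (-E)ᴴ Γ := by
    obtain ⟨Z, hZ⟩ := hΓ.exists_one_sub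
    exact ⟨hΓ.isHermitian, hΓ.mul_self, by simp [hΓ.mul_eq_zero], -Z, by simp [hZ]⟩
  have h1 := rank_add_posInertia_le_fromBlocks hG hΓ
  have h2 := rank_add_posInertia_le_fromBlocks hG.neg hΓ'
  have h3 : fromBlocks (-G) (-E) (-E)ᴴ 0 = -fromBlocks G E Eᴴ 0 := by
    simp [fromBlocks_neg]
  rw [h3, hM.posInertia_neg, rank_neg, Matrix.mul_neg, Matrix.neg_mul, ha.posInertia_neg] at h2
  have h4 := rank_fromBlocks_le (G := G) hΓ
  have h5 := hM.posInertia_add_negInertia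
  have h6 := ha.posInertia_add_negInertia
  omega

end BorderedInertia

/-! ### Minimal rank of a Hermitian completion -/

section MinimalRank

variable {ι κ μ σ : Type*} [Fintype ι] [Fintype κ]

/-- A Hermitian `U` with `U Z = D`, given that `Zᴴ D` is Hermitian and `Y` is an inverse of `Z` on
the relevant space. -/
theorem exists_isHermitian_mul_eq {Z D : Matrix ι κ ℂ} {Y : Matrix κ ι ℂ}
    (hD : D * (Y * Z) = D) (hZD : (Zᴴ * D).IsHermitian) :
    ∃ U : Matrix ι ι ℂ, U.IsHermitian ∧ U * Z = D := by
  have hDZ : Dᴴ * Z = Zᴴ * D := by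
    have := hZD.eq
    rwa [conjTranspose_mul, conjTranspose_conjTranspose] at this
  refine ⟨D * Y + (D * Y)ᴴ - Yᴴ * (Zᴴ * D) * Y, ?_, ?_⟩
  · refine IsHermitian.sub (isHermitian_add_transpose_self _) ?_
    exact isHermitian_conjTranspose_mul_mul _ hZD
  · rw [Matrix.sub_mul, Matrix.add_mul, conjTranspose_mul]
    simp only [Matrix.mul_assoc]
    rw [hD, hDZ, add_sub_cancel_right]

/-- The columns of `B` span the intersection of the column spaces of `Aᴴ` and `Cᴴ`. -/
structure SpansInf [Fintype μ] [Fintype σ] (A : Matrix κ ι ℂ) (C : Matrix μ ι ℂ)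
    (B : Matrix ι σ ℂ) : Prop where
  left : ∃ Γ : Matrix κ σ ℂ, B = Aᴴ * Γ
  right : ∃ Γ : Matrix μ σ ℂ, B = Cᴴ * Γ
  exists_eq : ∀ u v, Aᴴ *ᵥ u = Cᴴ *ᵥ v → ∃ s, Aᴴ *ᵥ u = B *ᵥ s

variable [Fintype μ] [Fintype σ]

/-- The lower bound for the rank: Frobenius' inequality bounds `rank H` below by `rank (A H)`, and the
latter by `rank (A H Cᴴ)`, up to ranks of blocks that involve `B`. -/
theorem IsHermitian.rank_add_le_of_spansInf {H : Matrix ι ι ℂ} (hH : H.IsHermitian)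
    {A : Matrix κ ι ℂ} {C : Matrix μ ι ℂ} {B : Matrix ι σ ℂ} (hB : SpansInf A C B) :
    2 * (H * B).rank + (A * H * Cᴴ).rank ≤ H.rank + (A * H * B).rank + (C * H * B).rank := by
  obtain ⟨Γ, hΓ⟩ := hB.left
  have h1 := rank_mul_add_rank_mul_le A H B
  -- `Γᴴ * A = Bᴴ`, so `B` enters here as a set of rows
  have h2 := rank_mul_add_rank_mul_le Γᴴ (A * H) Cᴴ
  have h3 : Γᴴ * (A * H) = (H * B)ᴴ := by
    rw [conjTranspose_mul, hΓ, conjTranspose_mul, hH.eq, conjTranspose_conjTranspose,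
      Matrix.mul_assoc]
  have h4 : (H * B)ᴴ * Cᴴ = (C * H * B)ᴴ := by rw [← conjTranspose_mul, Matrix.mul_assoc]
  rw [h3, h4, rank_conjTranspose, rank_conjTranspose] at h2
  omega

variable [DecidableEq ι]

/-- A Hermitian form that is prescribed only against the column space of `Cᴴ` can be completed to
one of rank `2 * rank (C H) - rank (C H Cᴴ)`: after splitting off the nondegenerate part of its
restriction to that space, what remains there is isotropic. -/
theorem IsHermitian.exists_rank_add_mul_mul_le [DecidableEq κ] {H : Matrix ι ι ℂ} (hH : H.IsHermitian)
    {C : Matrix κ ι ℂ} {Q : Matrix ι ι ℂ} (hQ : IsKerProj C Q) :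
    ∃ V : Matrix ι ι ℂ, V.IsHermitian ∧
      (H + Q * V * Q).rank + (C * H * Cᴴ).rank ≤ 2 * (C * H).rank := by
  have hG := isHermitian_mul_mul_conjTranspose C hH
  obtain ⟨g, hg, h1, h2, h3⟩ := hG.exists_pseudoinverse
  set G := C * H * Cᴴ with hGd
  -- `T` has rank at most that of `G` and, as a form, agrees with `H` on the column space of `Cᴴ`
  set T := H * Cᴴ * g * (C * H) with hT
  have hTh : T.IsHermitian := by
    rw [IsHermitian, hT]
    simp only [conjTranspose_mul, conjTranspose_conjTranspose, hH.eq, hg.eq, Matrix.mul_assoc]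
  have hR := hH.sub hTh
  have hTrank : T.rank ≤ G.rank := by
    have hgG : g.rank ≤ G.rank := by
      conv_lhs => rw [← h2]
      exact (Matrix.rank_mul_le_left _ _).trans (Matrix.rank_mul_le_right _ _)
    exact ((Matrix.rank_mul_le_left _ _).trans (Matrix.rank_mul_le_right _ _)).trans hgG
  obtain ⟨Z, hZ⟩ := hQ.exists_one_sub
  refine ⟨-(H - T), hR.neg, ?_⟩
  -- the correction removes from `H - T` the block on the range of `Q`; what remains has at most twice
  -- the rank of `C * (H - T)`
  have hdec : H + Q * -(H - T) * Q = T + ((1 - Q) * (H - T) + Q * ((1 - Q) * (H - T))ᴴ) := by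
    rw [conjTranspose_mul, hR.eq, conjTranspose_sub, conjTranspose_one, hQ.isHermitian.eq]
    noncomm_ring
  have hCR : C * (H - T) = (1 - G * g) * (C * H) := by
    rw [Matrix.mul_sub, Matrix.sub_mul, Matrix.one_mul, hT, hGd]
    simp only [Matrix.mul_assoc]
  have h4 := rank_mul_add_rank_mul_le (1 - G * g) (C * H) Cᴴ
  rw [← hGd, Matrix.mul_assoc (1 - G * g), ← hGd, Matrix.sub_mul _ _ G, Matrix.one_mul, h1,
    sub_self, rank_zero, ← hCR] at h4
  have h5 : ((1 - Q) * (H - T)).rank ≤ (C * (H - T)).rank := by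
    rw [hZ, Matrix.mul_assoc]
    exact Matrix.rank_mul_le_right _ _
  have h6 : (Q * ((1 - Q) * (H - T))ᴴ).rank ≤ ((1 - Q) * (H - T)).rank :=
    (Matrix.rank_mul_le_right _ _).trans (rank_conjTranspose _).le
  have h7 := rank_add_le T ((1 - Q) * (H - T) + Q * ((1 - Q) * (H - T))ᴴ)
  have h8 := rank_add_le ((1 - Q) * (H - T)) (Q * ((1 - Q) * (H - T))ᴴ)
  rw [hdec]
  omega

variable [DecidableEq μ] [DecidableEq σ]

/-- Among the Hermitian forms prescribed against the column space of `Aᴴ`, there is one whose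
restriction `C H` has the least rank compatible with the prescribed entries while its compression
`C H Cᴴ` has the largest. -/
theorem IsHermitian.exists_extremal_compression {H : Matrix ι ι ℂ} (hH : H.IsHermitian)
    {A : Matrix κ ι ℂ} {C : Matrix μ ι ℂ} {P : Matrix ι ι ℂ} {B : Matrix ι σ ℂ}
    (hP : IsKerProj A P) (hB : SpansInf A C B) :
    ∃ U : Matrix ι ι ℂ, U.IsHermitian ∧
      (C * (H + P * U * P)).rank + (A * H * B).rank ≤ (H * B).rank + (A * H * Cᴴ).rank ∧
      (A * H * Cᴴ).rank + (C * H * B).rank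
        ≤ (A * H * B).rank + (C * (H + P * U * P) * Cᴴ).rank := by
  obtain ⟨ΓA, hΓA⟩ := hB.left
  obtain ⟨Γ, hΓ⟩ := hB.right
  have hPB : P * B = 0 := by rw [hΓA, ← Matrix.mul_assoc, hP.mul_conjTranspose, Matrix.zero_mul]
  -- the columns of `L₀` span the part of the column space of `Cᴴ` which `A * H` kills
  obtain ⟨Φ, hΦ⟩ := exists_isKerProj (A * H * Cᴴ)
  set L₀ := Cᴴ * Φ with hL₀
  have hAL₀ : A * (H * L₀) = 0 := by
    rw [hL₀, ← Matrix.mul_assoc, ← Matrix.mul_assoc, hΦ.mul_eq_zero]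
  -- those of `L` span a complement of its intersection with the column space of `Aᴴ`
  obtain ⟨Ψ, hΨ⟩ := exists_isKerProj (P * L₀)
  obtain ⟨Y, hY⟩ := hΨ.exists_one_sub
  set L := L₀ * (1 - Ψ) with hL
  have hAL : A * (H * L) = 0 := by
    rw [hL, ← Matrix.mul_assoc H, ← Matrix.mul_assoc, hAL₀, Matrix.zero_mul]
  have hPHL : P * (H * L) = H * L := hP.mul_eq_self hAL
  have hPL : P * L = P * L₀ := by
    rw [hL, ← Matrix.mul_assoc, Matrix.mul_sub, Matrix.mul_one, hΨ.mul_eq_zero, sub_zero]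
  have hΨΨ : (1 - Ψ) * (1 - Ψ) = 1 - Ψ := by
    rw [Matrix.mul_sub, Matrix.mul_one, Matrix.sub_mul, Matrix.one_mul, hΨ.mul_self, sub_self,
      sub_zero]
  -- choose `U` so that the new form vanishes on the columns of `L`
  obtain ⟨U, hU, hUL⟩ : ∃ U : Matrix ι ι ℂ, U.IsHermitian ∧ U * (P * L) = -(H * L) := by
    refine exists_isHermitian_mul_eq (Y := Y) ?_ ?_
    · rw [hPL, ← hY, hL, Matrix.neg_mul, Matrix.mul_assoc H, Matrix.mul_assoc L₀, hΨΨ]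
    · have : (P * L)ᴴ * -(H * L) = -(Lᴴ * H * L) := by
        rw [conjTranspose_mul, hP.isHermitian.eq, Matrix.mul_neg, Matrix.mul_assoc, hPHL,
          Matrix.mul_assoc]
      rw [this]
      exact (isHermitian_conjTranspose_mul_mul L hH).neg
  set H' := H + P * U * P with hH'
  have hH'h : H'.IsHermitian := by
    refine hH.add ?_
    simpa [hP.isHermitian.eq] using isHermitian_conjTranspose_mul_mul P hU
  have hH'L : H' * L = 0 := by
    rw [hH', Matrix.add_mul, Matrix.mul_assoc, Matrix.mul_assoc, hUL, Matrix.mul_neg, hPHL,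
      add_neg_cancel]
  have hH'B : H' * B = H * B := by
    rw [hH', Matrix.add_mul, Matrix.mul_assoc _ P B, hPB, Matrix.mul_zero, add_zero]
  -- `Θ` projects onto the orthogonal complement of the column spaces of `Aᴴ` and `L`
  obtain ⟨Θ, hΘ⟩ := exists_isKerProj (fromRows A Lᴴ)
  have hAΘ : A * Θ = 0 ∧ Lᴴ * Θ = 0 := by
    have := hΘ.mul_eq_zero
    rwa [fromRows_mul, ← fromRows_zero, fromRows_ext_iff] at this
  have hΘA : Θ * Aᴴ = 0 := by
    have := congrArg Matrix.conjTranspose hAΘ.1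
    rwa [conjTranspose_mul, hΘ.isHermitian.eq, conjTranspose_zero] at this
  have hΘL : Θ * L = 0 := by
    have := congrArg Matrix.conjTranspose hAΘ.2
    rwa [conjTranspose_mul, hΘ.isHermitian.eq, conjTranspose_zero, conjTranspose_conjTranspose]
      at this
  have hΘB : Θ * B = 0 := by rw [hΓA, ← Matrix.mul_assoc, hΘA, Matrix.zero_mul]
  have hPΘ : P * Θ = Θ := hP.mul_eq_self hAΘ.1
  have hΘP : Θ * P = Θ := by
    have := congrArg Matrix.conjTranspose hPΘ
    rwa [conjTranspose_mul, hΘ.isHermitian.eq, hP.isHermitian.eq] at this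
  have hS : (C * Θ * Cᴴ).PosSemidef := hΘ.posSemidef.mul_mul_conjTranspose_same C
  obtain ⟨k, hk⟩ := (isHermitian_mul_mul_conjTranspose C hH'h).exists_forall_rank_add_rank_le hS
    (B := Γ) (by rw [Matrix.mul_assoc, ← hΓ, Matrix.mul_assoc, hΘB, Matrix.mul_zero])
  have hk := hk k le_rfl
  -- the large multiple of `Θ` makes the compression to the column space of `Cᴴ` have maximal rank
  refine ⟨U + ((k : ℝ) : ℂ) • Θ, ?_, ?_, ?_⟩
  · refine hU.add ?_
    simp [IsHermitian, hΘ.isHermitian.eq]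
  all_goals
    have hsum : H + P * (U + ((k : ℝ) : ℂ) • Θ) * P = H' + ((k : ℝ) : ℂ) • Θ := by
      rw [Matrix.mul_add, Matrix.add_mul, ← add_assoc, ← hH', Matrix.mul_smul, hPΘ,
        Matrix.smul_mul, hΘP]
    rw [hsum]
  · set H₁ := H' + ((k : ℝ) : ℂ) • Θ with hH₁
    have hH₁h : H₁.IsHermitian := by
      refine hH'h.add ?_
      simp [IsHermitian, hΘ.isHermitian.eq]
    have hH₁L : H₁ * L = 0 := by rw [hH₁, Matrix.add_mul, hH'L, Matrix.smul_mul, hΘL]; simp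
    have hH₁B : H₁ * B = H * B := by rw [hH₁, Matrix.add_mul, hH'B, Matrix.smul_mul, hΘB]; simp
    have h1 := rank_add_rank_mul_le_of_ker (K := H₁ * Cᴴ) (F := A * H * Cᴴ) (Γ := Γ) (by
      intro y hy
      have h2 : Φ *ᵥ y = y := hΦ.mulVec_eq_self hy
      have h3 : Cᴴ *ᵥ y = L₀ *ᵥ y := by rw [hL₀, ← mulVec_mulVec, h2]
      have h4 : L₀ *ᵥ y = L *ᵥ y + L₀ *ᵥ (Ψ *ᵥ y) := by
        rw [hL, Matrix.mul_sub, Matrix.mul_one, sub_mulVec, mulVec_mulVec, sub_add_cancel]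
      have h5 : P *ᵥ (L₀ *ᵥ (Ψ *ᵥ y)) = 0 := by
        rw [mulVec_mulVec, mulVec_mulVec, hΨ.mul_eq_zero, zero_mulVec]
      obtain ⟨u, hu⟩ := hP.exists_eq_conjTranspose_mulVec h5
      obtain ⟨s, hs⟩ := hB.exists_eq u (Φ *ᵥ (Ψ *ᵥ y)) (by
        rw [← hu, hL₀, ← mulVec_mulVec])
      refine ⟨s, ?_⟩
      rw [Matrix.mul_assoc, ← hΓ, ← mulVec_mulVec, h3, h4, mulVec_add, mulVec_mulVec, hH₁L,
        zero_mulVec, zero_add, hu, hs, mulVec_mulVec])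
    rw [Matrix.mul_assoc H₁, ← hΓ, hH₁B, Matrix.mul_assoc (A * H) _ Γ, ← hΓ] at h1
    have h6 : (C * H₁).rank = (H₁ * Cᴴ).rank := by
      rw [← rank_conjTranspose, conjTranspose_mul, hH₁h.eq]
    rw [h6]
    exact h1
  · have h1 := rank_add_rank_mul_le_of_ker (K := A * H * Cᴴ) (F := Θ * Cᴴ) (Γ := Γ) (by
      intro y hy
      rw [← mulVec_mulVec] at hy
      obtain ⟨w, hw⟩ := hΘ.exists_eq_conjTranspose_mulVec hy
      rw [conjTranspose_fromRows_eq_fromCols_conjTranspose, conjTranspose_conjTranspose,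
        fromCols_mulVec] at hw
      obtain ⟨s, hs⟩ := hB.exists_eq (w ∘ Sum.inl) (y - Φ *ᵥ ((1 - Ψ) *ᵥ (w ∘ Sum.inr))) (by
        rw [mulVec_sub, hw, mulVec_mulVec, ← hL₀, mulVec_mulVec, ← hL, add_sub_cancel_right])
      refine ⟨s, ?_⟩
      rw [Matrix.mul_assoc (A * H), ← hΓ, ← mulVec_mulVec, hw, hs, mulVec_add, mulVec_mulVec,
        mulVec_mulVec, Matrix.mul_assoc A H L, hAL, zero_mulVec, add_zero])
    rw [Matrix.mul_assoc Θ, ← hΓ, Matrix.mul_assoc (A * H) _ Γ, ← hΓ, hΘB, rank_zero,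
      add_zero] at h1
    have h2 : (C * Θ * Cᴴ).rank = (Θ * Cᴴ).rank := by
      rw [← rank_conjTranspose_mul_self (Θ * Cᴴ), conjTranspose_mul, conjTranspose_conjTranspose,
        hΘ.isHermitian.eq, ← Matrix.mul_assoc, Matrix.mul_assoc C Θ Θ, hΘ.mul_self]
    have h3 : C * H' * Cᴴ * Γ = C * H * B := by
      rw [Matrix.mul_assoc, ← hΓ, Matrix.mul_assoc, hH'B, Matrix.mul_assoc]
    have h4 : C * (H' + ((k : ℝ) : ℂ) • Θ) * Cᴴ
        = C * H' * Cᴴ + ((k : ℝ) : ℂ) • (C * Θ * Cᴴ) := by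
      rw [Matrix.mul_add, Matrix.add_mul, Matrix.mul_smul, Matrix.smul_mul]
    rw [h4]
    rw [h2, h3] at hk
    omega

/-- The minimal rank is attained: `P U P` first brings `C H` and `C H Cᴴ` into extremal position, and
`Q V Q`, which leaves them unchanged, then completes the form with the least rank. -/
theorem IsHermitian.exists_rank_add_le {H : Matrix ι ι ℂ} (hH : H.IsHermitian)
    {A : Matrix κ ι ℂ} {C : Matrix μ ι ℂ} {P Q : Matrix ι ι ℂ} {B : Matrix ι σ ℂ}
    (hP : IsKerProj A P) (hQ : IsKerProj C Q) (hB : SpansInf A C B) :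
    ∃ U V : Matrix ι ι ℂ, U.IsHermitian ∧ V.IsHermitian ∧
      (H + P * U * P + Q * V * Q).rank + (A * H * B).rank + (C * H * B).rank
        ≤ 2 * (H * B).rank + (A * H * Cᴴ).rank := by
  obtain ⟨U, hU, h1, h2⟩ := hH.exists_extremal_compression hP hB
  have hH₁ : (H + P * U * P).IsHermitian := by
    refine hH.add ?_
    simpa [hP.isHermitian.eq] using isHermitian_conjTranspose_mul_mul P hU
  obtain ⟨V, hV, h3⟩ := hH₁.exists_rank_add_mul_mul_le hQ
  exact ⟨U, V, hU, hV, by omega⟩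

end MinimalRank

/-! ### Extremal inertia of a Hermitian completion -/

section ExtremalInertia

variable {ι κ μ σ : Type*} [Fintype ι] [Fintype κ] [Fintype μ] [Fintype σ]

theorem SpansInf.rank_add_rank_fromRows {A : Matrix κ ι ℂ} {C : Matrix μ ι ℂ}
    {B : Matrix ι σ ℂ} (hB : SpansInf A C B) :
    B.rank + (fromRows A C).rank = A.rank + C.rank := by
  have h1 : LinearMap.range B.mulVecLin
      = LinearMap.range (Aᴴ).mulVecLin ⊓ LinearMap.range (Cᴴ).mulVecLin := by
    obtain ⟨ΓA, hΓA⟩ := hB.left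
    obtain ⟨ΓC, hΓC⟩ := hB.right
    apply le_antisymm
    · refine le_inf ?_ ?_
      · rw [hΓA, mulVecLin_mul]
        exact LinearMap.range_comp_le_range _ _
      · rw [hΓC, mulVecLin_mul]
        exact LinearMap.range_comp_le_range _ _
    · rintro x ⟨⟨u, hu⟩, ⟨v, hv⟩⟩
      obtain ⟨s, hs⟩ := hB.exists_eq u v (hu.trans hv.symm)
      exact ⟨s, hs.symm.trans hu⟩
  have h2 := Submodule.finrank_sup_add_finrank_inf_eq (LinearMap.range (Aᴴ).mulVecLin)
    (LinearMap.range (Cᴴ).mulVecLin)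
  rw [← h1, ← range_mulVecLin_fromCols, ← conjTranspose_fromRows_eq_fromCols_conjTranspose] at h2
  change (fromRows A C)ᴴ.rank + B.rank = Aᴴ.rank + Cᴴ.rank at h2
  rw [rank_conjTranspose, rank_conjTranspose, rank_conjTranspose] at h2
  omega

variable [DecidableEq ι]

/-- The kernel of `P + Q` is the intersection of the kernels of `P` and `Q`, hence the column space
of `B`. -/
theorem SpansInf.card_le_rank_add_rank {A : Matrix κ ι ℂ} {C : Matrix μ ι ℂ}
    {B : Matrix ι σ ℂ} (hB : SpansInf A C B) {P Q : Matrix ι ι ℂ}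
    (hP : IsKerProj A P) (hQ : IsKerProj C Q) :
    Fintype.card ι ≤ (P + Q).rank + B.rank := by
  have h1 : LinearMap.ker (P + Q).mulVecLin ≤ LinearMap.range B.mulVecLin := by
    intro x hx
    have hx' : star x ⬝ᵥ (P *ᵥ x) + star x ⬝ᵥ (Q *ᵥ x) = 0 := by
      rw [← dotProduct_add, ← add_mulVec, show (P + Q) *ᵥ x = 0 from hx, dotProduct_zero]
    obtain ⟨hp, hq⟩ := (add_eq_zero_iff_of_nonneg (hP.posSemidef.dotProduct_mulVec_nonneg x)
      (hQ.posSemidef.dotProduct_mulVec_nonneg x)).1 hx'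
    obtain ⟨u, hu⟩ := hP.exists_eq_conjTranspose_mulVec
      ((hP.posSemidef.dotProduct_mulVec_zero_iff x).1 hp)
    obtain ⟨v, hv⟩ := hQ.exists_eq_conjTranspose_mulVec
      ((hQ.posSemidef.dotProduct_mulVec_zero_iff x).1 hq)
    obtain ⟨s, hs⟩ := hB.exists_eq u v (hu.symm.trans hv)
    exact ⟨s, (hu.trans hs).symm⟩
  have h2 := Submodule.finrank_mono h1
  have h3 := rank_add_finrank_ker (P + Q)
  have h4 : B.rank = Module.finrank ℂ (LinearMap.range B.mulVecLin) := rfl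
  omega

/-- Adding a large multiple of `P + Q` simultaneously maximizes the rank and the number of positive
eigenvalues and minimizes the number of negative ones. -/
theorem IsHermitian.exists_extremal_inertia [DecidableEq σ] {H : Matrix ι ι ℂ}
    (hH : H.IsHermitian)
    {A : Matrix κ ι ℂ} {C : Matrix μ ι ℂ} {B : Matrix ι σ ℂ} (hB : SpansInf A C B)
    {P Q : Matrix ι ι ℂ} (hP : IsKerProj A P) (hQ : IsKerProj C Q) :
    ∃ t : ℝ, posInertia (Bᴴ * H * B) + Fintype.card ι
        ≤ posInertia (H + (t : ℂ) • (P + Q)) + B.rank ∧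
      negInertia (H + (t : ℂ) • (P + Q)) + posInertia (Bᴴ * H * B) ≤ (H * B).rank ∧
      Fintype.card ι + (H * B).rank ≤ (H + (t : ℂ) • (P + Q)).rank + B.rank := by
  have hS := hP.posSemidef.add hQ.posSemidef
  have hSB : (P + Q) * B = 0 := by
    obtain ⟨ΓA, hΓA⟩ := hB.left
    obtain ⟨ΓC, hΓC⟩ := hB.right
    rw [Matrix.add_mul]
    conv_lhs => rw [hΓA, ← Matrix.mul_assoc, hP.mul_conjTranspose, ← hΓA, hΓC, ← Matrix.mul_assoc,
      hQ.mul_conjTranspose]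
    simp
  have h1 := hB.card_le_rank_add_rank hP hQ
  obtain ⟨k₁, hk₁⟩ := hH.exists_forall_posInertia_add_rank_le hS hSB
  obtain ⟨k₂, hk₂⟩ := hH.exists_forall_rank_add_rank_le hS hSB
  set t : ℝ := max k₁ k₂
  have h2 := hk₁ t (le_max_left _ _)
  have h3 := hk₂ t (le_max_right _ _)
  have hHt : (H + (t : ℂ) • (P + Q)).IsHermitian := by
    refine hH.add ?_
    rw [IsHermitian, conjTranspose_smul, hS.isHermitian.eq]
    simp
  have h4 := hHt.posInertia_add_negInertia
  have h5 := rank_add_rank_le_rank_mul_add_card (H + (t : ℂ) • (P + Q)) B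
  rw [Matrix.add_mul, Matrix.smul_mul, hSB, smul_zero, add_zero] at h5
  exact ⟨t, by omega, by omega, by omega⟩

end ExtremalInertia

/-! ### The block matrices of the problem -/

section Invariants

variable {m n : ℕ} {A C : Matrix (Fin m) (Fin n) ℂ}
  {Γ : Matrix (Fin m ⊕ Fin m) (Fin m ⊕ Fin m) ℂ}

theorem IsKerProj.conjTranspose_mul_toRows (hΓ : IsKerProj (fromRows A C)ᴴ Γ) :
    Cᴴ * Γ.toRows₂ = -(Aᴴ * Γ.toRows₁) := by
  have h := hΓ.mul_eq_zero
  rw [conjTranspose_fromRows_eq_fromCols_conjTranspose, ← fromRows_toRows Γ,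
    fromCols_mul_fromRows] at h
  exact eq_neg_of_add_eq_zero_right h

/-- A pair `(u, w)` in the kernel of `[Aᴴ, Cᴴ]` is the same as a vector `Aᴴ u = -Cᴴ w` of the
intersection. -/
theorem IsKerProj.spansInf (hΓ : IsKerProj (fromRows A C)ᴴ Γ) :
    SpansInf A C (Aᴴ * Γ.toRows₁) where
  left := ⟨_, rfl⟩
  right := ⟨-Γ.toRows₂, by rw [Matrix.mul_neg, hΓ.conjTranspose_mul_toRows, neg_neg]⟩
  exists_eq u v huv := by
    refine ⟨Sum.elim u (-v), ?_⟩
    have h : Γ *ᵥ Sum.elim u (-v) = Sum.elim u (-v) := hΓ.mulVec_eq_self (by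
      rw [conjTranspose_fromRows_eq_fromCols_conjTranspose, fromCols_mulVec]
      simp [mulVec_neg, huv])
    have h1 : Γ.toRows₁ *ᵥ Sum.elim u (-v) = u := by
      funext i
      exact congrFun h (Sum.inl i)
    rw [← mulVec_mulVec, h1]

theorem IsKerProj.mul_fromRows (hΓ : IsKerProj (fromRows A C)ᴴ Γ) {τ : Type*}
    (X Y : Matrix (Fin n) τ ℂ) :
    Γ * fromRows (A * X) (C * Y) = (Aᴴ * Γ.toRows₁)ᴴ * (X - Y) := by
  have h1 : Γ = fromCols Γ.toRows₁ᴴ Γ.toRows₂ᴴ := by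
    rw [← conjTranspose_fromRows_eq_fromCols_conjTranspose, fromRows_toRows, hΓ.isHermitian.eq]
  have h2 : Γ.toRows₂ᴴ * C = -(Aᴴ * Γ.toRows₁)ᴴ := by
    rw [← conjTranspose_neg, ← hΓ.conjTranspose_mul_toRows, conjTranspose_mul,
      conjTranspose_conjTranspose]
  conv_lhs => rw [h1]
  rw [fromCols_mul_fromRows, ← Matrix.mul_assoc, ← Matrix.mul_assoc, h2, conjTranspose_mul,
    conjTranspose_conjTranspose, Matrix.neg_mul, Matrix.mul_sub, sub_eq_add_neg]

/-- With `X` and `Y` solutions of the two equations, possibly multiplied by a common factor on the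
right, this gives the ranks of `N` and of the two other block matrices. -/
theorem IsKerProj.rank_fromBlocks (hΓ : IsKerProj (fromRows A C)ᴴ Γ) {p : ℕ}
    (X Y : Matrix (Fin n) (Fin p) ℂ) :
    (fromBlocks A (A * X) C (C * Y)).rank
      = (fromRows A C).rank + ((Aᴴ * Γ.toRows₁)ᴴ * (X - Y)).rank := by
  have h : fromBlocks A (A * X) C (C * Y)
      = fromCols (fromRows A C) (fromRows (A * X) (C * Y)) := by
    ext (i | i) (j | j) <;> rfl
  rw [h, hΓ.rank_fromCols, hΓ.mul_fromRows]

theorem IsKerProj.inertia_matM (hΓ : IsKerProj (fromRows A C)ᴴ Γ)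
    {X Y : Matrix (Fin n) (Fin n) ℂ} (hX : X.IsHermitian) (hY : Y.IsHermitian) :
    posInertia (matM A (A * X) C (C * Y))
        = (fromRows A C).rank
          + posInertia ((Aᴴ * Γ.toRows₁)ᴴ * (X - Y) * (Aᴴ * Γ.toRows₁)) ∧
      negInertia (matM A (A * X) C (C * Y))
        = (fromRows A C).rank
          + negInertia ((Aᴴ * Γ.toRows₁)ᴴ * (X - Y) * (Aᴴ * Γ.toRows₁)) := by
  set G : Matrix (Fin m ⊕ Fin m) (Fin m ⊕ Fin m) ℂ :=
    fromBlocks (A * X * Aᴴ) 0 0 (-(C * Y * Cᴴ)) with hGdef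
  have hG : G.IsHermitian := (isHermitian_mul_mul_conjTranspose A hX).fromBlocks (by simp)
    (isHermitian_mul_mul_conjTranspose C hY).neg
  have hM : matM A (A * X) C (C * Y) = fromBlocks G (fromRows A C) (fromRows A C)ᴴ 0 := by
    rw [matM, hGdef, conjTranspose_mul, conjTranspose_mul, hX.eq, hY.eq, Matrix.mul_assoc,
      Matrix.mul_assoc, conjTranspose_fromRows_eq_fromCols_conjTranspose]
  have hGΓ : Γ * G * Γ = (Aᴴ * Γ.toRows₁)ᴴ * (X - Y) * (Aᴴ * Γ.toRows₁) := by
    have h1 : G * Γ = fromRows (A * (X * (Aᴴ * Γ.toRows₁))) (C * (Y * (Aᴴ * Γ.toRows₁))) := by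
      conv_lhs => rw [← fromRows_toRows Γ, hGdef]
      rw [fromBlocks_mul_fromRows]
      simp only [Matrix.mul_assoc, Matrix.neg_mul, hΓ.conjTranspose_mul_toRows, Matrix.mul_neg,
        neg_neg, Matrix.zero_mul, add_zero, zero_add]
    rw [Matrix.mul_assoc, h1, hΓ.mul_fromRows, ← Matrix.sub_mul, Matrix.mul_assoc]
  rw [hM, ← hGΓ]
  exact inertia_fromBlocks_zero hG hΓ

end Invariants

/-! ### Reading off consequences from extremal values -/

section Extrema

variable {α : Type*} [Sub α] {S T : Set α} {f : α → ℕ} {v : ℤ} {N : ℕ}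

theorem exists_eq_iff_of_isGreatest
    (h : IsGreatest {k : ℤ | ∃ X ∈ S, ∃ Y ∈ T, k = (f (X - Y) : ℤ)} v)
    (hN : ∀ X ∈ S, ∀ Y ∈ T, f (X - Y) ≤ N) :
    (∃ X ∈ S, ∃ Y ∈ T, f (X - Y) = N) ↔ v = N := by
  constructor
  · rintro ⟨X, hX, Y, hY, hf⟩
    obtain ⟨X', hX', Y', hY', hv⟩ := h.1
    have h1 := h.2 ⟨X, hX, Y, hY, rfl⟩
    have h2 := hN X' hX' Y' hY'
    omega
  · rintro rfl
    obtain ⟨X, hX, Y, hY, hv⟩ := h.1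
    exact ⟨X, hX, Y, hY, by exact_mod_cast hv.symm⟩

theorem forall_eq_iff_of_isLeast
    (h : IsLeast {k : ℤ | ∃ X ∈ S, ∃ Y ∈ T, k = (f (X - Y) : ℤ)} v)
    (hN : ∀ X ∈ S, ∀ Y ∈ T, f (X - Y) ≤ N) :
    (∀ X ∈ S, ∀ Y ∈ T, f (X - Y) = N) ↔ v = N := by
  obtain ⟨X', hX', Y', hY', hv⟩ := h.1
  constructor
  · intro hf
    rw [hv, hf X' hX' Y' hY']
  · rintro rfl X hX Y hY
    have h1 := h.2 ⟨X, hX, Y, hY, rfl⟩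
    have h2 := hN X hX Y hY
    omega

theorem exists_eq_zero_iff_of_isLeast
    (h : IsLeast {k : ℤ | ∃ X ∈ S, ∃ Y ∈ T, k = (f (X - Y) : ℤ)} v) :
    (∃ X ∈ S, ∃ Y ∈ T, f (X - Y) = 0) ↔ v = 0 := by
  constructor
  · rintro ⟨X, hX, Y, hY, hf⟩
    obtain ⟨X', hX', Y', hY', hv⟩ := h.1
    have h1 := h.2 ⟨X, hX, Y, hY, rfl⟩
    omega
  · rintro rfl
    obtain ⟨X, hX, Y, hY, hv⟩ := h.1
    exact ⟨X, hX, Y, hY, by exact_mod_cast hv.symm⟩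

theorem forall_eq_zero_iff_of_isGreatest
    (h : IsGreatest {k : ℤ | ∃ X ∈ S, ∃ Y ∈ T, k = (f (X - Y) : ℤ)} v) :
    (∀ X ∈ S, ∀ Y ∈ T, f (X - Y) = 0) ↔ v = 0 := by
  obtain ⟨X', hX', Y', hY', hv⟩ := h.1
  constructor
  · intro hf
    rw [hv, hf X' hX' Y' hY', Nat.cast_zero]
  · rintro rfl X hX Y hY
    have h1 := h.2 ⟨X, hX, Y, hY, rfl⟩
    omega

end Extrema

theorem isUnit_iff_rank_eq {n : ℕ} (H : Matrix (Fin n) (Fin n) ℂ) :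
    IsUnit H ↔ H.rank = n := by
  refine ⟨fun h => by simpa using rank_of_isUnit H h, fun h => ?_⟩
  rw [← mulVec_surjective_iff_isUnit]
  have h1 : LinearMap.range H.mulVecLin = ⊤ := by
    apply Submodule.eq_top_of_finrank_eq
    simpa [Matrix.rank] using h
  exact LinearMap.range_eq_top.1 h1

theorem eq_zero_of_rank_eq_zero {ι κ : Type*} [Finite ι] [Fintype κ] {H : Matrix ι κ ℂ}
    (h : H.rank = 0) : H = 0 := by
  have := Fintype.ofFinite ι
  have h1 : LinearMap.range H.mulVecLin = ⊥ := Submodule.finrank_eq_zero.1 h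
  classical
  ext i j
  simpa using congrFun (LinearMap.congr_fun (LinearMap.range_eq_bot.1 h1) (Pi.single j 1)) i

end Matrix

theorem theorem3p1 (m n : ℕ) (A B C D : Matrix (Fin m) (Fin n) ℂ)
    (hS : (hermSol A B).Nonempty) (hT : (hermSol C D).Nonempty) :
    -- extremal ranks of `X - Y`
    IsGreatest {k : ℤ | ∃ X ∈ hermSol A B, ∃ Y ∈ hermSol C D, k = ((X - Y).rank : ℤ)}
      ((n : ℤ) + (matN A B C D).rank - A.rank - C.rank) ∧
    IsLeast {k : ℤ | ∃ X ∈ hermSol A B, ∃ Y ∈ hermSol C D, k = ((X - Y).rank : ℤ)}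
      (2 * ((matN A B C D).rank : ℤ) + (A * Dᴴ - B * Cᴴ).rank
        - (Matrix.fromBlocks A (B * Aᴴ) C (D * Aᴴ)).rank
        - (Matrix.fromBlocks A (B * Cᴴ) C (D * Cᴴ)).rank) ∧
    -- extremal inertias of `X - Y`
    IsGreatest {k : ℤ | ∃ X ∈ hermSol A B, ∃ Y ∈ hermSol C D, k = (posInertia (X - Y) : ℤ)}
      ((n : ℤ) + posInertia (matM A B C D) - A.rank - C.rank) ∧
    IsGreatest {k : ℤ | ∃ X ∈ hermSol A B, ∃ Y ∈ hermSol C D, k = (negInertia (X - Y) : ℤ)}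
      ((n : ℤ) + negInertia (matM A B C D) - A.rank - C.rank) ∧
    IsLeast {k : ℤ | ∃ X ∈ hermSol A B, ∃ Y ∈ hermSol C D, k = (posInertia (X - Y) : ℤ)}
      (((matN A B C D).rank : ℤ) - negInertia (matM A B C D)) ∧
    IsLeast {k : ℤ | ∃ X ∈ hermSol A B, ∃ Y ∈ hermSol C D, k = (negInertia (X - Y) : ℤ)}
      (((matN A B C D).rank : ℤ) - posInertia (matM A B C D)) ∧
    -- (a) some difference is nonsingular
    ((∃ X ∈ hermSol A B, ∃ Y ∈ hermSol C D, IsUnit (X - Y)) ↔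
      (matN A B C D).rank = A.rank + C.rank) ∧
    -- (b) every difference is nonsingular
    ((∀ X ∈ hermSol A B, ∀ Y ∈ hermSol C D, IsUnit (X - Y)) ↔
      2 * (matN A B C D).rank + (A * Dᴴ - B * Cᴴ).rank
        = (Matrix.fromBlocks A (B * Aᴴ) C (D * Aᴴ)).rank
          + (Matrix.fromBlocks A (B * Cᴴ) C (D * Cᴴ)).rank + n) ∧
    -- (c) there is a common Hermitian solution
    ((hermSol A B ∩ hermSol C D).Nonempty ↔
      LinearMap.range (Matrix.fromRows B D).mulVecLin
          ≤ LinearMap.range (Matrix.fromRows A C).mulVecLin ∧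
        Matrix.fromRows A C * Matrix.fromCols Bᴴ Dᴴ
          = Matrix.fromRows B D * Matrix.fromCols Aᴴ Cᴴ) ∧
    -- (d) `X ≻ Y`, respectively `X ≺ Y`, for some `X`, `Y`
    ((∃ X ∈ hermSol A B, ∃ Y ∈ hermSol C D, (X - Y).PosDef) ↔
      posInertia (matM A B C D) = A.rank + C.rank) ∧
    ((∃ X ∈ hermSol A B, ∃ Y ∈ hermSol C D, (Y - X).PosDef) ↔
      negInertia (matM A B C D) = A.rank + C.rank) ∧
    -- (e) `X ≻ Y`, respectively `X ≺ Y`, for all `X`, `Y`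
    ((∀ X ∈ hermSol A B, ∀ Y ∈ hermSol C D, (X - Y).PosDef) ↔
      (negInertia (matM A B C D) : ℤ) = (matN A B C D).rank - n) ∧
    ((∀ X ∈ hermSol A B, ∀ Y ∈ hermSol C D, (Y - X).PosDef) ↔
      (posInertia (matM A B C D) : ℤ) = (matN A B C D).rank - n) ∧
    -- (f) `X ≽ Y`, respectively `X ≼ Y`, for some `X`, `Y`
    ((∃ X ∈ hermSol A B, ∃ Y ∈ hermSol C D, (X - Y).PosSemidef) ↔
      posInertia (matM A B C D) = (matN A B C D).rank) ∧
    ((∃ X ∈ hermSol A B, ∃ Y ∈ hermSol C D, (Y - X).PosSemidef) ↔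
      negInertia (matM A B C D) = (matN A B C D).rank) ∧
    -- (g) `X ≽ Y`, respectively `X ≼ Y`, for all `X`, `Y`
    ((∀ X ∈ hermSol A B, ∀ Y ∈ hermSol C D, (X - Y).PosSemidef) ↔
      (negInertia (matM A B C D) : ℤ) = A.rank + C.rank - n) ∧
    ((∀ X ∈ hermSol A B, ∀ Y ∈ hermSol C D, (Y - X).PosSemidef) ↔
      (posInertia (matM A B C D) : ℤ) = A.rank + C.rank - n) := by
  classical
  obtain ⟨Γ, hΓ⟩ := Matrix.exists_isKerProj (Matrix.fromRows A C)ᴴ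
  obtain ⟨P, hP⟩ := Matrix.exists_isKerProj A
  obtain ⟨Q, hQ⟩ := Matrix.exists_isKerProj C
  have hW := hΓ.spansInf
  obtain ⟨W, hWdef⟩ : ∃ W, W = Aᴴ * Γ.toRows₁ := ⟨_, rfl⟩
  rw [← hWdef] at hW
  obtain ⟨X₀, hX₀⟩ := hS
  obtain ⟨Y₀, hY₀⟩ := hT
  have hherm : ∀ X ∈ hermSol A B, ∀ Y ∈ hermSol C D, (X - Y).IsHermitian :=
    fun X hX Y hY => hX.1.sub hY.1
  have hH₀ := hherm X₀ hX₀ Y₀ hY₀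
  obtain ⟨H₀, hH₀def⟩ : ∃ H₀, H₀ = X₀ - Y₀ := ⟨_, rfl⟩
  rw [← hH₀def] at hH₀
  -- `(X - Y) * W` does not depend on the choice of the solutions `X` and `Y`
  have hWH : ∀ X ∈ hermSol A B, ∀ Y ∈ hermSol C D, (X - Y) * W = H₀ * W := by
    intro X hX Y hY
    have h1 := hΓ.mul_fromRows X Y
    have h2 := hΓ.mul_fromRows X₀ Y₀
    rw [hX.2, hY.2, ← hWdef] at h1
    rw [hX₀.2, hY₀.2, ← hWdef, ← hH₀def, h1] at h2
    have h3 := congrArg Matrix.conjTranspose h2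
    rwa [Matrix.conjTranspose_mul, Matrix.conjTranspose_mul, Matrix.conjTranspose_conjTranspose,
      (hherm X hX Y hY).eq, hH₀.eq] at h3
  -- the ranks and inertias of the block matrices in terms of `H₀` and `W`
  have hrW := hW.rank_add_rank_fromRows
  set rE := (Matrix.fromRows A C).rank with hrE
  have hrank : ∀ {p : ℕ} (R : Matrix (Fin p) (Fin n) ℂ),
      (Matrix.fromBlocks A (B * Rᴴ) C (D * Rᴴ)).rank = rE + (R * H₀ * W).rank := by
    intro p R
    rw [← hX₀.2, ← hY₀.2, Matrix.mul_assoc, Matrix.mul_assoc, hΓ.rank_fromBlocks, ← Matrix.sub_mul,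
      ← hWdef, ← hH₀def, ← hrE, ← Matrix.rank_conjTranspose (R * H₀ * W)]
    simp only [Matrix.conjTranspose_mul, hH₀.eq, Matrix.mul_assoc]
  have hN : (matN A B C D).rank = rE + (H₀ * W).rank := by
    have := hrank (1 : Matrix (Fin n) (Fin n) ℂ)
    simpa [matN] using this
  have hNA := hrank A
  have hNC := hrank C
  have hAD : (A * Dᴴ - B * Cᴴ).rank = (A * H₀ * Cᴴ).rank := by
    have : A * Dᴴ - B * Cᴴ = -(A * H₀ * Cᴴ) := by
      rw [← hX₀.2, ← hY₀.2, Matrix.conjTranspose_mul, hY₀.1.eq, hH₀def, Matrix.mul_sub,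
        Matrix.sub_mul, neg_sub, Matrix.mul_assoc A Y₀]
    rw [this, Matrix.rank_neg]
  obtain ⟨hMp, hMn⟩ := hΓ.inertia_matM hX₀.1 hY₀.1
  rw [hX₀.2, hY₀.2, ← hWdef, ← hH₀def, ← hrE] at hMp hMn
  have ha : (Wᴴ * H₀ * W).IsHermitian := Matrix.isHermitian_conjTranspose_mul_mul W hH₀
  have hWHW : ∀ X ∈ hermSol A B, ∀ Y ∈ hermSol C D, Wᴴ * (X - Y) * W = Wᴴ * H₀ * W := by
    intro X hX Y hY
    rw [Matrix.mul_assoc, hWH X hX Y hY, Matrix.mul_assoc]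
  -- bounds that hold for every difference `X - Y`
  have hmaxr : ∀ X ∈ hermSol A B, ∀ Y ∈ hermSol C D,
      (X - Y).rank + W.rank ≤ (H₀ * W).rank + n := by
    intro X hX Y hY
    have := Matrix.rank_add_rank_le_rank_mul_add_card (X - Y) W
    rwa [hWH X hX Y hY, Fintype.card_fin] at this
  have hmaxp : ∀ X ∈ hermSol A B, ∀ Y ∈ hermSol C D,
      posInertia (X - Y) + W.rank ≤ posInertia (Wᴴ * H₀ * W) + n := by
    intro X hX Y hY
    have := (hherm X hX Y hY).posInertia_add_rank_le W
    rwa [hWHW X hX Y hY, Fintype.card_fin] at this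
  have hmaxn : ∀ X ∈ hermSol A B, ∀ Y ∈ hermSol C D,
      negInertia (X - Y) + W.rank ≤ negInertia (Wᴴ * H₀ * W) + n := by
    intro X hX Y hY
    have := (hherm X hX Y hY).neg.posInertia_add_rank_le W
    rwa [Matrix.mul_neg, Matrix.neg_mul, hWHW X hX Y hY, ha.posInertia_neg,
      (hherm X hX Y hY).posInertia_neg, Fintype.card_fin] at this
  have hminp : ∀ X ∈ hermSol A B, ∀ Y ∈ hermSol C D,
      (H₀ * W).rank ≤ posInertia (X - Y) + negInertia (Wᴴ * H₀ * W) := by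
    intro X hX Y hY
    have := (hherm X hX Y hY).rank_mul_le W
    rwa [hWHW X hX Y hY, hWH X hX Y hY] at this
  have hminn : ∀ X ∈ hermSol A B, ∀ Y ∈ hermSol C D,
      (H₀ * W).rank ≤ negInertia (X - Y) + posInertia (Wᴴ * H₀ * W) := by
    intro X hX Y hY
    have := (hherm X hX Y hY).neg.rank_mul_le W
    rwa [Matrix.mul_neg, Matrix.neg_mul, Matrix.neg_mul, hWHW X hX Y hY, hWH X hX Y hY,
      Matrix.rank_neg, ha.negInertia_neg, (hherm X hX Y hY).posInertia_neg] at this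
  have hminr : ∀ X ∈ hermSol A B, ∀ Y ∈ hermSol C D,
      2 * (H₀ * W).rank + (A * H₀ * Cᴴ).rank
        ≤ (X - Y).rank + (A * H₀ * W).rank + (C * H₀ * W).rank := by
    intro X hX Y hY
    have h1 := (hherm X hX Y hY).rank_add_le_of_spansInf hW
    have h2 : A * (X - Y) * Cᴴ = A * H₀ * Cᴴ := by
      have hYC : Y * Cᴴ = Y₀ * Cᴴ := by
        have := congrArg Matrix.conjTranspose (hY.2.trans hY₀.2.symm)
        rwa [Matrix.conjTranspose_mul, Matrix.conjTranspose_mul, hY.1.eq, hY₀.1.eq] at this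
      rw [hH₀def, Matrix.mul_sub, Matrix.mul_sub, Matrix.sub_mul, Matrix.sub_mul, hX.2, hX₀.2,
        Matrix.mul_assoc A Y, hYC, ← Matrix.mul_assoc A]
    rwa [h2, Matrix.mul_assoc A _ W, Matrix.mul_assoc C _ W, hWH X hX Y hY, ← Matrix.mul_assoc,
      ← Matrix.mul_assoc] at h1
  -- every Hermitian perturbation supported on the kernels of `A` and `C` is realized
  have hreal : ∀ U V : Matrix (Fin n) (Fin n) ℂ, U.IsHermitian → V.IsHermitian →
      ∃ X ∈ hermSol A B, ∃ Y ∈ hermSol C D, X - Y = H₀ + P * U * P + Q * V * Q := by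
    intro U V hU hV
    refine ⟨X₀ + P * U * P, ⟨hX₀.1.add ?_, ?_⟩, Y₀ - Q * V * Q, ⟨hY₀.1.sub ?_, ?_⟩, ?_⟩
    · simpa [hP.isHermitian.eq] using Matrix.isHermitian_conjTranspose_mul_mul P hU
    · rw [Matrix.mul_add, ← Matrix.mul_assoc, ← Matrix.mul_assoc, hP.mul_eq_zero, Matrix.zero_mul,
        Matrix.zero_mul, add_zero, hX₀.2]
    · simpa [hQ.isHermitian.eq] using Matrix.isHermitian_conjTranspose_mul_mul Q hV
    · rw [Matrix.mul_sub, ← Matrix.mul_assoc, ← Matrix.mul_assoc, hQ.mul_eq_zero, Matrix.zero_mul,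
        Matrix.zero_mul, sub_zero, hY₀.2]
    · rw [hH₀def]
      abel
  have hreal' : ∀ t : ℝ,
      ∃ X ∈ hermSol A B, ∃ Y ∈ hermSol C D, X - Y = H₀ + (t : ℂ) • (P + Q) := by
    intro t
    have ht : ((t : ℂ) • (1 : Matrix (Fin n) (Fin n) ℂ)).IsHermitian := by
      simp [Matrix.IsHermitian]
    obtain ⟨X, hX, Y, hY, h⟩ := hreal _ _ ht ht
    refine ⟨X, hX, Y, hY, h.trans ?_⟩
    simp [hP.mul_self, hQ.mul_self, smul_add, add_assoc]
  obtain ⟨t₁, hp₁, hn₁, hr₁⟩ := hH₀.exists_extremal_inertia hW hP hQ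
  obtain ⟨t₂, hp₂, hn₂, hr₂⟩ := hH₀.neg.exists_extremal_inertia hW hP hQ
  obtain ⟨X₁, hX₁, Y₁, hY₁, h₁⟩ := hreal' t₁
  obtain ⟨X₂, hX₂, Y₂, hY₂, h₂⟩ := hreal' (-t₂)
  rw [← h₁, Fintype.card_fin] at hp₁ hr₁
  rw [← h₁] at hn₁
  have h₂' : -H₀ + (t₂ : ℂ) • (P + Q) = -(X₂ - Y₂) := by
    rw [h₂]
    push_cast
    rw [neg_smul]
    abel
  have hh₂ := hherm X₂ hX₂ Y₂ hY₂
  rw [h₂', hh₂.posInertia_neg, Matrix.mul_neg, Matrix.neg_mul, ha.posInertia_neg,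
    Fintype.card_fin] at hp₂
  rw [h₂', hh₂.negInertia_neg, Matrix.mul_neg, Matrix.neg_mul, ha.posInertia_neg, Matrix.neg_mul,
    Matrix.rank_neg] at hn₂
  obtain ⟨U, V, hU, hV, hr₃⟩ := hH₀.exists_rank_add_le hP hQ hW
  obtain ⟨X₃, hX₃, Y₃, hY₃, h₃⟩ := hreal U V hU hV
  rw [← h₃] at hr₃
  have hGr : IsGreatest {k : ℤ | ∃ X ∈ hermSol A B, ∃ Y ∈ hermSol C D, k = ((X - Y).rank : ℤ)}
      ((n : ℤ) + (matN A B C D).rank - A.rank - C.rank) := by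
    constructor
    · have := hmaxr X₁ hX₁ Y₁ hY₁
      exact ⟨X₁, hX₁, Y₁, hY₁, by omega⟩
    · rintro _ ⟨X, hX, Y, hY, rfl⟩
      have := hmaxr X hX Y hY
      omega
  have hLr : IsLeast {k : ℤ | ∃ X ∈ hermSol A B, ∃ Y ∈ hermSol C D, k = ((X - Y).rank : ℤ)}
      (2 * ((matN A B C D).rank : ℤ) + (A * Dᴴ - B * Cᴴ).rank
        - (Matrix.fromBlocks A (B * Aᴴ) C (D * Aᴴ)).rank
        - (Matrix.fromBlocks A (B * Cᴴ) C (D * Cᴴ)).rank) := by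
    constructor
    · have := hminr X₃ hX₃ Y₃ hY₃
      exact ⟨X₃, hX₃, Y₃, hY₃, by omega⟩
    · rintro _ ⟨X, hX, Y, hY, rfl⟩
      have := hminr X hX Y hY
      omega
  have hGp : IsGreatest
      {k : ℤ | ∃ X ∈ hermSol A B, ∃ Y ∈ hermSol C D, k = (posInertia (X - Y) : ℤ)}
      ((n : ℤ) + posInertia (matM A B C D) - A.rank - C.rank) := by
    constructor
    · have := hmaxp X₁ hX₁ Y₁ hY₁
      exact ⟨X₁, hX₁, Y₁, hY₁, by omega⟩
    · rintro _ ⟨X, hX, Y, hY, rfl⟩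
      have := hmaxp X hX Y hY
      omega
  have hGn : IsGreatest
      {k : ℤ | ∃ X ∈ hermSol A B, ∃ Y ∈ hermSol C D, k = (negInertia (X - Y) : ℤ)}
      ((n : ℤ) + negInertia (matM A B C D) - A.rank - C.rank) := by
    constructor
    · have := hmaxn X₂ hX₂ Y₂ hY₂
      exact ⟨X₂, hX₂, Y₂, hY₂, by omega⟩
    · rintro _ ⟨X, hX, Y, hY, rfl⟩
      have := hmaxn X hX Y hY
      omega
  have hLp : IsLeast
      {k : ℤ | ∃ X ∈ hermSol A B, ∃ Y ∈ hermSol C D, k = (posInertia (X - Y) : ℤ)}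
      (((matN A B C D).rank : ℤ) - negInertia (matM A B C D)) := by
    constructor
    · have := hminp X₂ hX₂ Y₂ hY₂
      exact ⟨X₂, hX₂, Y₂, hY₂, by omega⟩
    · rintro _ ⟨X, hX, Y, hY, rfl⟩
      have := hminp X hX Y hY
      omega
  have hLn : IsLeast
      {k : ℤ | ∃ X ∈ hermSol A B, ∃ Y ∈ hermSol C D, k = (negInertia (X - Y) : ℤ)}
      (((matN A B C D).rank : ℤ) - posInertia (matM A B C D)) := by
    constructor
    · have := hminn X₁ hX₁ Y₁ hY₁
      exact ⟨X₁, hX₁, Y₁, hY₁, by omega⟩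
    · rintro _ ⟨X, hX, Y, hY, rfl⟩
      have := hminn X hX Y hY
      omega
  have hle : ∀ X ∈ hermSol A B, ∀ Y ∈ hermSol C D, (X - Y).rank ≤ n :=
    fun X _ Y _ => Matrix.rank_le_height _
  have hlep : ∀ X ∈ hermSol A B, ∀ Y ∈ hermSol C D, posInertia (X - Y) ≤ n := by
    intro X hX Y hY
    have h1 := (hherm X hX Y hY).posInertia_add_negInertia
    have h2 := hle X hX Y hY
    omega
  have hlen : ∀ X ∈ hermSol A B, ∀ Y ∈ hermSol C D, negInertia (X - Y) ≤ n := by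
    intro X hX Y hY
    have h1 := (hherm X hX Y hY).posInertia_add_negInertia
    have h2 := hle X hX Y hY
    omega
  -- definiteness of `X - Y` and of `Y - X` in terms of the inertia of `X - Y`
  have hpd : ∀ X ∈ hermSol A B, ∀ Y ∈ hermSol C D, ((X - Y).PosDef ↔ posInertia (X - Y) = n) := by
    intro X hX Y hY
    rw [(hherm X hX Y hY).posDef_iff_posInertia_eq, Fintype.card_fin]
  have hnd : ∀ X ∈ hermSol A B, ∀ Y ∈ hermSol C D, ((Y - X).PosDef ↔ negInertia (X - Y) = n) := by
    intro X hX Y hY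
    have h := hherm X hX Y hY
    rw [← neg_sub X Y, h.neg.posDef_iff_posInertia_eq, h.posInertia_neg, Fintype.card_fin]
  have hps : ∀ X ∈ hermSol A B, ∀ Y ∈ hermSol C D,
      ((X - Y).PosSemidef ↔ negInertia (X - Y) = 0) :=
    fun X hX Y hY => (hherm X hX Y hY).posSemidef_iff_negInertia_eq_zero
  have hns : ∀ X ∈ hermSol A B, ∀ Y ∈ hermSol C D,
      ((Y - X).PosSemidef ↔ posInertia (X - Y) = 0) := by
    intro X hX Y hY
    have h := hherm X hX Y hY
    rw [← neg_sub X Y, h.neg.posSemidef_iff_negInertia_eq_zero, h.negInertia_neg]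
  have hex : ∀ {p q : Matrix (Fin n) (Fin n) ℂ → Matrix (Fin n) (Fin n) ℂ → Prop},
      (∀ X ∈ hermSol A B, ∀ Y ∈ hermSol C D, (p X Y ↔ q X Y)) →
      ((∃ X ∈ hermSol A B, ∃ Y ∈ hermSol C D, p X Y) ↔
        ∃ X ∈ hermSol A B, ∃ Y ∈ hermSol C D, q X Y) := fun h =>
    exists_congr fun X => and_congr_right fun hX => exists_congr fun Y => and_congr_right fun hY =>
      h X hX Y hY
  have hall : ∀ {p q : Matrix (Fin n) (Fin n) ℂ → Matrix (Fin n) (Fin n) ℂ → Prop},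
      (∀ X ∈ hermSol A B, ∀ Y ∈ hermSol C D, (p X Y ↔ q X Y)) →
      ((∀ X ∈ hermSol A B, ∀ Y ∈ hermSol C D, p X Y) ↔
        ∀ X ∈ hermSol A B, ∀ Y ∈ hermSol C D, q X Y) := fun h =>
    forall₂_congr fun X hX => forall₂_congr fun Y hY => h X hX Y hY
  refine ⟨hGr, hLr, hGp, hGn, hLp, hLn, ?_, ?_, ?_, ?_, ?_, ?_, ?_, ?_, ?_, ?_, ?_⟩
  · rw [hex fun X _ Y _ => Matrix.isUnit_iff_rank_eq (X - Y),
      Matrix.exists_eq_iff_of_isGreatest (f := Matrix.rank) hGr hle]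
    omega
  · rw [hall fun X _ Y _ => Matrix.isUnit_iff_rank_eq (X - Y),
      Matrix.forall_eq_iff_of_isLeast (f := Matrix.rank) hLr hle]
    omega
  · constructor
    · rintro ⟨X, hX, hX'⟩
      have h1 : Matrix.fromRows B D = Matrix.fromRows A C * X := by
        rw [Matrix.fromRows_mul, hX.2, hX'.2]
      have h2 : Matrix.fromCols Bᴴ Dᴴ = X * Matrix.fromCols Aᴴ Cᴴ := by
        rw [← Matrix.conjTranspose_fromRows_eq_fromCols_conjTranspose, h1,
          Matrix.conjTranspose_mul, hX.1.eq,
          Matrix.conjTranspose_fromRows_eq_fromCols_conjTranspose]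
      refine ⟨?_, ?_⟩
      · rw [h1, Matrix.mulVecLin_mul]
        exact LinearMap.range_comp_le_range _ _
      · rw [h1, h2, Matrix.mul_assoc]
    · rintro ⟨h1, h2⟩
      -- the minimal rank vanishes: `H₀ * W = 0` by the first and `A * H₀ * Cᴴ = 0` by the second
      -- hypothesis
      have h3 : (matN A B C D).rank = rE := by
        have : matN A B C D = Matrix.fromCols (Matrix.fromRows A C) (Matrix.fromRows B D) := by
          ext (i | i) (j | j) <;> rfl
        rw [this, Matrix.rank, Matrix.range_mulVecLin_fromCols, sup_eq_left.2 h1, hrE, Matrix.rank]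
      have h4 : (A * Dᴴ - B * Cᴴ).rank = 0 := by
        rw [Matrix.fromRows_mul_fromCols, Matrix.fromRows_mul_fromCols,
          Matrix.fromBlocks_inj] at h2
        rw [h2.2.1, sub_self, Matrix.rank_zero]
      have h5 : (X₃ - Y₃).rank = 0 := by omega
      have h6 : X₃ = Y₃ := sub_eq_zero.1 (Matrix.eq_zero_of_rank_eq_zero h5)
      exact ⟨X₃, hX₃, h6 ▸ hY₃⟩
  · rw [hex hpd, Matrix.exists_eq_iff_of_isGreatest (f := posInertia) hGp hlep]
    omega
  · rw [hex hnd, Matrix.exists_eq_iff_of_isGreatest (f := negInertia) hGn hlen]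
    omega
  · rw [hall hpd, Matrix.forall_eq_iff_of_isLeast (f := posInertia) hLp hlep]
    omega
  · rw [hall hnd, Matrix.forall_eq_iff_of_isLeast (f := negInertia) hLn hlen]
    omega
  · rw [hex hps, Matrix.exists_eq_zero_iff_of_isLeast (f := negInertia) hLn]
    omega
  · rw [hex hns, Matrix.exists_eq_zero_iff_of_isLeast (f := posInertia) hLp]
    omega
  · rw [hall hps, Matrix.forall_eq_zero_iff_of_isGreatest (f := negInertia) hGn]
    omega
  · rw [hall hns, Matrix.forall_eq_zero_iff_of_isGreatest (f := posInertia) hGp]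
    omega
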